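/- Let $\lambda\in\mathbb R$ and let $q:\mathbb R\to\mathbb R$ be integrable and vanish outside $[\alpha,\beta]$, where $\alpha<0<\beta$. Suppose that for some integers $p,r\ge 1$ the $(p-1)$-th derivative of $q$ has a jump discontinuity at $\beta$ and the $(r-1)$-th derivative of $q$ has a jump discontinuity at $\alpha$. (The $k$-th derivative has a jump discontinuity at a point if it exists in a punctured neighbourhood of that point and has there two different finite one-sided limits.) Put $s=\sqrt{1/4-\lambda}$, $V_0(x)=\lambda/\cosh^2 x$, $V=V_0+q$, and for $z\in\mathbb C\setminus\{-i,-2i,\dots\}$ let $$f_0^+(x,z)=e^{izx}\,{}_2F_1\Big(\tfrac12-s,\tfrac12+s,1-iz;\tfrac1{1+e^{2x}}\Big),\qquad f_0^-(x,z)=f_0^+(-x,z)$$ be the Jost solutions of $-y''+V_0y=z^2y$, with $f_0^\pm\sim e^{\pm izx}$ as $x\to\pm\infty$. Let $K^+$ be the continuous solution on $\{x\le t\}$, vanishing for $t\ge 2\beta-x$, of $$K^+(x,t)=\tfrac12\int_{\frac{x+t}2}^{\beta}q(\tau)\,d\tau+\int_{\frac{x+t}2}^{\beta}\int_0^{\frac{t-x}2}\big(V(\tau-u)-V_0(\tau+u)\big)K^+(\tau-u,\tau+u)\,du\,d\tau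 ,$$ and $K^-$ the continuous solution on $\{t\le x\}$, vanishing for $t\le 2\alpha-x$, of $$K^-(x,t)=\tfrac12\int_{\alpha}^{\frac{x+t}2}q(\tau)\,d\tau+\int_{\alpha}^{\frac{x+t}2}\int_{\frac{t-x}2}^0\big(V(\tau-u)-V_0(\tau+u)\big)K^-(\tau-u,\tau+u)\,du\,d\tau .$$ The Jost solutions of $-y''+Vy=z^2y$ are $$f^+(x,z)=f_0^+(x,z)+\mathbf 1_{x<\beta}\int_x^{2\beta-x}K^+(x,t)f_0^+(t,z)\,dt,\qquad f^-(x,z)=f_0^-(x,z)+\mathbf 1_{x>\alpha}\int_{2\alpha-x}^xK^-(x,t)f_0^-(t,z)\,dt .$$ With $[f,g]=fg'-f'g$, let $w_0(z)=[f_0^-(\cdot,z),f_0^+(\cdot,z)]$ and $w(z)=[f^-(\cdot,z),f^+(\cdot,z)]$ (these Wronskians do not depend on $x$ and are evaluated at $x=0$). The zeros of $w_0$, resp. $w$, with negative imaginary part are the unperturbed (Pöschl–Teller), resp. perturbed, resonances. For $\delta,\eta>0$ let $$S_1=\{z:\ \Im z<0,\ -|\Re z|\ge\delta\,\Im z\},\quad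 \mathcal B=\bigcup_{n\ge0}B(-i(n+1),\eta),\quad Z=\{z:\ f^-(0,z)\,(f^+)'(0,z)=0\},$$ where $B(\cdot,\eta)$ denotes the open disc of radius $\eta$. Then, for all $\delta,\eta>0$: 1. $w$ has asymptotically no zeros (no resonances) in $S_1\setminus(\mathcal B\cup Z)$: there is $R$ such that $w(z)\ne0$ for every $z\in S_1\setminus(\mathcal B\cup Z)$ with $|z|\ge R$. 2. The Pöschl–Teller resonances disappear: for every $\varepsilon>0$ there is $R$ such that, for every zero $z_0\in S_1$ of $w_0$ with $|z_0|\ge R$, one has $w(z)\ne0$ for all $z$ with $|z-z_0|\le\varepsilon$ and $z\notin\mathcal B$. -/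

import Mathlib

open Filter Topology MeasureTheory

noncomputable section

namespace PoschlTeller

/-- The square root of `1/4 - lam`: nonnegative real if `lam ≤ 1/4`, and `i` times a positive real
if `lam > 1/4`. -/
def root (lam : ℝ) : ℂ :=
  if 0 ≤ 1 / 4 - lam then ((Real.sqrt (1 / 4 - lam) : ℝ) : ℂ)
  else Complex.I * ((Real.sqrt (-(1 / 4 - lam)) : ℝ) : ℂ)

/-- Hypergeometric parameter `a = 1/2 - i z + √(1/4 - lam)`. -/
def parA (lam : ℝ) (z : ℂ) : ℂ := 1 / 2 - Complex.I * z + root lam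

/-- Hypergeometric parameter `b = 1/2 - i z - √(1/4 - lam)`. -/
def parB (lam : ℝ) (z : ℂ) : ℂ := 1 / 2 - Complex.I * z - root lam

/-- Hypergeometric parameter `c = 1 - i z`. -/
def parC (z : ℂ) : ℂ := 1 - Complex.I * z

/-- The Jost solution at `+∞` of `-y'' + lam / cosh² x * y = z² y`, namely
`e^{izx} F(c-a, c-b, c; 1/(1+e^{2x}))`, which by Euler's transformation is
`(2 cosh x)^{iz} F(a, b, c; 1/(1+e^{2x}))`. It has poles at `z = -i(n+1)`, `n ∈ ℕ`. -/
def jostFreePlus (lam : ℝ) (x : ℝ) (z : ℂ) : ℂ :=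
  Complex.exp (Complex.I * z * x) *
    ordinaryHypergeometric (parC z - parA lam z) (parC z - parB lam z) (parC z)
      ((1 / (1 + Real.exp (2 * x)) : ℝ) : ℂ)

/-- The Jost solution at `-∞` of `-y'' + lam / cosh² x * y = z² y`. -/
def jostFreeMinus (lam : ℝ) (x : ℝ) (z : ℂ) : ℂ :=
  Complex.exp (-(Complex.I * z * x)) *
    ordinaryHypergeometric (parC z - parA lam z) (parC z - parB lam z) (parC z)
      ((Real.exp (2 * x) / (1 + Real.exp (2 * x)) : ℝ) : ℂ)

/-- The Pöschl-Teller potential. -/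
def freePot (lam : ℝ) (x : ℝ) : ℝ := lam / Real.cosh x ^ 2

/-- The perturbed potential `V`. -/
def pot (lam : ℝ) (q : ℝ → ℝ) (x : ℝ) : ℝ := freePot lam x + q x

/-- Picard iterates for the integral equation of the transformation kernel at `+∞`,
`K(x,t) = 1/2 ∫_{(x+t)/2}^β q
  + ∫_{(x+t)/2}^β ∫_0^{(t-x)/2} (V(τ-u) - lam/cosh²(τ+u)) K(τ-u, τ+u) du dτ`, for `x ≤ t`. -/
def kernelPlusIter (lam : ℝ) (q : ℝ → ℝ) (β : ℝ) : ℕ → ℝ → ℝ → ℝ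
  | 0 => fun x t => (1 / 2) * ∫ s in ((x + t) / 2)..β, q s
  | m + 1 => fun x t =>
      ∫ τ in ((x + t) / 2)..β, ∫ u in (0 : ℝ)..((t - x) / 2),
        (pot lam q (τ - u) - freePot lam (τ + u)) * kernelPlusIter lam q β m (τ - u) (τ + u)

/-- The transformation kernel at `+∞`: the Neumann series of the integral equation above. On
`x ≤ t` it converges to the unique continuous solution vanishing for `t ≥ 2β - x`. -/
def kernelPlus (lam : ℝ) (q : ℝ → ℝ) (β : ℝ) (x t : ℝ) : ℝ :=
  ∑' m : ℕ, kernelPlusIter lam q β m x t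

/-- Picard iterates for the integral equation of the transformation kernel at `-∞`,
`K(x,t) = 1/2 ∫_α^{(x+t)/2} q
  + ∫_α^{(x+t)/2} ∫_{(t-x)/2}^0 (V(τ-u) - lam/cosh²(τ+u)) K(τ-u, τ+u) du dτ`, for `t ≤ x`. -/
def kernelMinusIter (lam : ℝ) (q : ℝ → ℝ) (α : ℝ) : ℕ → ℝ → ℝ → ℝ
  | 0 => fun x t => (1 / 2) * ∫ s in α..((x + t) / 2), q s
  | m + 1 => fun x t =>
      ∫ τ in α..((x + t) / 2), ∫ u in ((t - x) / 2)..(0 : ℝ),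
        (pot lam q (τ - u) - freePot lam (τ + u)) * kernelMinusIter lam q α m (τ - u) (τ + u)

/-- The transformation kernel at `-∞`: the Neumann series of the integral equation above. On
`t ≤ x` it converges to the unique continuous solution vanishing for `t ≤ 2α - x`. -/
def kernelMinus (lam : ℝ) (q : ℝ → ℝ) (α : ℝ) (x t : ℝ) : ℝ :=
  ∑' m : ℕ, kernelMinusIter lam q α m x t

/-- The Jost solution at `+∞` of `-y'' + V y = z² y`. -/
def jostPlus (lam : ℝ) (q : ℝ → ℝ) (β : ℝ) (x : ℝ) (z : ℂ) : ℂ :=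
  jostFreePlus lam x z +
    if x < β then
      ∫ t in x..(2 * β - x), ((kernelPlus lam q β x t : ℝ) : ℂ) * jostFreePlus lam t z
    else 0

/-- The Jost solution at `-∞` of `-y'' + V y = z² y`. -/
def jostMinus (lam : ℝ) (q : ℝ → ℝ) (α : ℝ) (x : ℝ) (z : ℂ) : ℂ :=
  jostFreeMinus lam x z +
    if α < x then
      ∫ t in (2 * α - x)..x, ((kernelMinus lam q α x t : ℝ) : ℂ) * jostFreeMinus lam t z
    else 0

/-- The Wronskian `[f, g] = f g' - f' g` at the point `x`. -/
def wronskian (f g : ℝ → ℂ) (x : ℝ) : ℂ := f x * deriv g x - deriv f x * g x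

/-- The Jost function `w₀(z) = [f₀⁻(·,z), f₀⁺(·,z)]` of the unperturbed potential. The Wronskian
does not depend on the point; it is evaluated at `0`. -/
def jostFreeW (lam : ℝ) (z : ℂ) : ℂ :=
  wronskian (fun x => jostFreeMinus lam x z) (fun x => jostFreePlus lam x z) 0

/-- The Jost function `w(z) = [f⁻(·,z), f⁺(·,z)]`. The Wronskian does not depend on the point; it
is evaluated at `0`. -/
def jostW (lam : ℝ) (q : ℝ → ℝ) (α β : ℝ) (z : ℂ) : ℂ :=
  wronskian (fun x => jostMinus lam q α x z) (fun x => jostPlus lam q β x z) 0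

/-- The sector `S₁` of the lower half-plane. -/
def sectorOne (δ : ℝ) : Set ℂ := {z | z.im < 0 ∧ -|z.re| ≥ δ * z.im}

/-- The union of the open discs of radius `η` centred at `-i(n+1)`, `n ∈ ℕ`. -/
def discs (η : ℝ) : Set ℂ := ⋃ n : ℕ, Metric.ball (-(Complex.I * ((n : ℂ) + 1))) η

/-- The set `Z` of zeros of `f⁻(0,z) (f⁺)'(0,z)`. -/
def zeroSet (lam : ℝ) (q : ℝ → ℝ) (α β : ℝ) : Set ℂ :=
  {z | jostMinus lam q α 0 z * deriv (fun x => jostPlus lam q β x z) 0 = 0}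

/-- The `k`-th derivative of `q` has a jump discontinuity at `a`: it exists at every point near `a`
other than `a` itself, and its one-sided limits at `a` exist and differ. -/
def DerivJumpAt (k : ℕ) (q : ℝ → ℝ) (a : ℝ) : Prop :=
  (∀ j < k, ∀ᶠ x in 𝓝[≠] a, DifferentiableAt ℝ (iteratedDeriv j q) x) ∧
    ∃ l r : ℝ, l ≠ r ∧ Tendsto (iteratedDeriv k q) (𝓝[<] a) (𝓝 l) ∧
      Tendsto (iteratedDeriv k q) (𝓝[>] a) (𝓝 r)

end PoschlTeller

end

/-!
The theorem holds because, far out in the sector `S₁` and away from the poles, the Jost solutions at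
`x = 0` are dominated by the wave reflected at the edge of the support of `q`.

Write `y = -Im z > 0`. In the characteristic coordinates `τ = (x + t) / 2`,
`u = (t - x) / 2` the transformation kernel is a continuous function `charKernel τ u` which is
continuously differentiable in `u`, even though `q` is only integrable. The Jost solution at `0` is
`f₀⁺(0) + 2 ∫₀^β K(τ, τ) f₀⁺(2τ) dτ`, and its derivative is given by a similar integral with `f₀⁺'`,
up to terms of lower order (`hasDerivAt_integral_kernelPlus_mul`). The jump of a derivative of `q`
at `β` forces `q`, hence `K(τ, τ)`, to vanish at `β` exactly to some finite order
(`exists_order_of_derivJumpAt`, `exists_charKernel_asymptotics`). That order may be smaller than the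
one suggested by the index of the derivative, since lower derivatives may jump as well.

Away from the poles `f₀⁺(2τ) = e^{2izτ} (1 + o(1))` for `β / 2 ≤ τ ≤ β`, while for smaller `τ` a
crude exponential bound suffices. Both follow from one estimate of the hypergeometric coefficients,
whose denominators are shifted factorials of a parameter near the negative axis
(`factorial_le_prod`, `exists_norm_jostCoeff_le`). As `|e^{2izτ}| = e^{2yτ}` increases with `τ`, a
form of Watson's lemma (`tendsto_exp_integral`) gives, after multiplication by an explicit
normalizing factor, `f⁺(0, z) → L ≠ 0` and `f⁺'(0, z) / (iz) → -L`
(`exists_jostPlus_asymptotics`).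

The solution `f⁻` is the reflection of such an `f⁺` (`jostMinus_eq`). Hence the two products in the
Wronskian have the same nonzero limit instead of cancelling, and `w(z) ≠ 0` in every sector, near
infinity and off the discs (`eventually_jostW_ne_zero`). The points concerned lie outside `Z`
automatically, and the statement about neighbourhoods of the unperturbed resonances follows by using
a slightly wider sector.
-/

noncomputable section

namespace PoschlTeller

open Set intervalIntegral
open scoped Interval

variable {lam α β δ η : ℝ} {q : ℝ → ℝ}

/-! ### The transformation kernel in characteristic coordinates -/

/-- The coefficient of the integral equation of the kernel in the characteristic coordinates
`τ = (x + t) / 2`, `u = (t - x) / 2`. -/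
def charPot (lam : ℝ) (q : ℝ → ℝ) (τ u : ℝ) : ℝ := pot lam q (τ - u) - freePot lam (τ + u)

/-- The `m`-th Picard iterate of the kernel in characteristic coordinates. -/
def charIter (lam : ℝ) (q : ℝ → ℝ) (β : ℝ) (m : ℕ) (τ u : ℝ) : ℝ :=
  kernelPlusIter lam q β m (τ - u) (τ + u)

/-- The derivative of the `(m + 1)`-st Picard iterate in the second characteristic coordinate. -/
def charIterSlope (lam : ℝ) (q : ℝ → ℝ) (β : ℝ) (m : ℕ) (τ u : ℝ) : ℝ :=
  ∫ σ in τ..β, charPot lam q σ u * charIter lam q β m σ u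

lemma charIter_zero (τ u : ℝ) : charIter lam q β 0 τ u = 1 / 2 * ∫ s in τ..β, q s := by
  simp only [charIter, kernelPlusIter]
  congr 3
  ring

lemma charIter_succ (m : ℕ) (τ u : ℝ) : charIter lam q β (m + 1) τ u =
    ∫ σ in τ..β, ∫ v in (0 : ℝ)..u, charPot lam q σ v * charIter lam q β m σ v := by
  simp only [charIter, kernelPlusIter, charPot]
  congr! <;> ring

lemma continuous_freePot (lam : ℝ) : Continuous (freePot lam) := by
  unfold freePot
  exact continuous_const.div (by fun_prop) fun x => by positivity

lemma abs_freePot_le (lam x : ℝ) : |freePot lam x| ≤ |lam| := by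
  unfold freePot
  rw [abs_div, abs_of_pos (show (0 : ℝ) < Real.cosh x ^ 2 by positivity)]
  exact div_le_self (abs_nonneg _) (one_le_pow₀ (Real.one_le_cosh x))

lemma charPot_eq (τ u : ℝ) :
    charPot lam q τ u = q (τ - u) + (freePot lam (τ - u) - freePot lam (τ + u)) := by
  unfold charPot pot
  ring

lemma continuous_shifted_integral (hq : Integrable q) {Φ : ℝ → ℝ → ℝ}
    (hΦ : Continuous (Function.uncurry Φ)) :
    Continuous fun p : ℝ × ℝ => ∫ σ in p.1..β, q (σ - p.2) * Φ σ p.2 := by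
  have key : Continuous fun p : ℝ × ℝ => ∫ s in (0 : ℝ)..p.2, q s * Φ (s + p.1) p.1 := by
    refine continuous_iff_continuousAt.2 fun ⟨u, b⟩ => ?_
    obtain ⟨C, hC⟩ := (isCompact_Icc.prod isCompact_Icc : IsCompact
      (Icc (-(|u| + |b| + 3)) (|u| + |b| + 3) ×ˢ Icc (u - 1) (u + 1))).exists_bound_of_continuousOn
      hΦ.continuousOn
    refine continuousAt_parametric_primitive_of_dominated (X := ℝ)
      (F := fun u s => q s * Φ (s + u) u) (fun s => |q s| * C)
      (-(|b| + 1)) (|b| + 1) ?_ ?_ ?_ ?_ ?_ ?_ ?_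
    · intro x
      refine hq.aestronglyMeasurable.restrict.mul (Continuous.aestronglyMeasurable ?_)
      exact hΦ.comp (by fun_prop : Continuous fun s : ℝ => (s + x, x))
    · filter_upwards [Ioo_mem_nhds (show u - 1 < u by linarith) (show u < u + 1 by linarith)]
        with x hx
      refine (ae_restrict_iff' measurableSet_uIoc).2 (Eventually.of_forall fun s hs => ?_)
      rw [uIoc_of_le (by linarith [abs_nonneg b])] at hs
      rw [norm_mul]
      refine mul_le_mul_of_nonneg_left (hC (s + x, x) ⟨⟨?_, ?_⟩, hx.1.le, hx.2.le⟩) (norm_nonneg _)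
      · linarith [hs.1, hx.1, neg_abs_le u]
      · linarith [hs.2, hx.2, le_abs_self u]
    · exact ((hq.abs.mul_const C).intervalIntegrable)
    · exact Eventually.of_forall fun s => (continuous_const.mul
        (hΦ.comp (by fun_prop : Continuous fun x : ℝ => (s + x, x)))).continuousAt
    · exact ⟨by linarith [abs_nonneg b], by linarith [abs_nonneg b]⟩
    · exact ⟨by linarith [neg_abs_le b], by linarith [le_abs_self b]⟩
    · simp
  have h2 : (fun p : ℝ × ℝ => ∫ σ in p.1..β, q (σ - p.2) * Φ σ p.2) = fun p : ℝ × ℝ =>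
      (∫ s in (0 : ℝ)..(β - p.2), q s * Φ (s + p.2) p.2)
        - ∫ s in (0 : ℝ)..(p.1 - p.2), q s * Φ (s + p.2) p.2 := by
    ext ⟨τ, u⟩
    have hint : ∀ a b, IntervalIntegrable (fun s => q s * Φ (s + u) u) volume a b := fun a b =>
      (hq.intervalIntegrable).mul_continuousOn
        (hΦ.comp (by fun_prop : Continuous fun s : ℝ => (s + u, u))).continuousOn
    have := integral_comp_sub_right (a := τ) (b := β) (fun s => q s * Φ (s + u) u) u
    simp only [sub_add_cancel] at this
    simp only [this]
    rw [integral_interval_sub_left (hint _ _) (hint _ _)]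
  rw [h2]
  exact (key.comp (by fun_prop : Continuous fun p : ℝ × ℝ => (p.2, β - p.2))).sub
    (key.comp (by fun_prop : Continuous fun p : ℝ × ℝ => (p.2, p.1 - p.2)))

lemma intervalIntegrable_charPot_mul (hq : Integrable q) {g : ℝ → ℝ} (hg : Continuous g)
    (u a b : ℝ) : IntervalIntegrable (fun σ => charPot lam q σ u * g σ) volume a b := by
  refine IntervalIntegrable.mul_continuousOn ?_ hg.continuousOn
  simp only [charPot_eq]
  refine (hq.comp_sub_right u).intervalIntegrable.add (Continuous.intervalIntegrable ?_ _ _)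
  have := continuous_freePot lam
  fun_prop

lemma continuous_charPot_integral (hq : Integrable q) {Φ : ℝ → ℝ → ℝ}
    (hΦ : Continuous (Function.uncurry Φ)) :
    Continuous fun p : ℝ × ℝ => ∫ σ in p.1..β, charPot lam q σ p.2 * Φ σ p.2 := by
  have hV := continuous_freePot lam
  have hΦu : ∀ u, Continuous fun σ => Φ σ u := fun u =>
    hΦ.comp (by fun_prop : Continuous fun s : ℝ => (s, u))
  have : (fun p : ℝ × ℝ => ∫ σ in p.1..β, charPot lam q σ p.2 * Φ σ p.2) = fun p : ℝ × ℝ =>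
      (∫ σ in p.1..β, q (σ - p.2) * Φ σ p.2) -
        ∫ σ in β..p.1, (freePot lam (σ - p.2) - freePot lam (σ + p.2)) * Φ σ p.2 := by
    ext ⟨τ, u⟩
    simp only [charPot_eq, add_mul]
    rw [intervalIntegral.integral_add, integral_symm τ β, sub_neg_eq_add]
    · exact (hq.comp_sub_right u).intervalIntegrable.mul_continuousOn (hΦu u).continuousOn
    · refine Continuous.intervalIntegrable ?_ _ _
      have := hΦu u
      fun_prop
  rw [this]
  refine (continuous_shifted_integral hq hΦ).sub ?_
  refine continuous_parametric_intervalIntegral_of_continuous (a₀ := β)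
    (f := fun (p : ℝ × ℝ) σ => (freePot lam (σ - p.2) - freePot lam (σ + p.2)) * Φ σ p.2) ?_
    continuous_fst
  refine Continuous.mul (by fun_prop) ?_
  exact hΦ.comp (by fun_prop : Continuous fun p : (ℝ × ℝ) × ℝ => (p.2, p.1.2))

lemma integrableOn_charPot (hq : Integrable q) (a b c d : ℝ) :
    IntegrableOn (Function.uncurry (charPot lam q)) (uIcc a b ×ˢ uIcc c d) := by
  have h1 : Integrable ((uIcc c d).indicator fun _ => (1 : ℝ)) := by
    rw [integrable_indicator_iff measurableSet_uIcc]
    simp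
  have h2 := h1.convolution_integrand (ContinuousLinearMap.mul ℝ ℝ) hq
  have h3 : IntegrableOn (fun p : ℝ × ℝ => q (p.1 - p.2)) (uIcc a b ×ˢ uIcc c d) := by
    refine (h2.integrableOn (s := uIcc a b ×ˢ uIcc c d)).congr_fun ?_
      (measurableSet_uIcc.prod measurableSet_uIcc)
    intro p hp
    simp [indicator_of_mem hp.2]
  have h4 : IntegrableOn (fun p : ℝ × ℝ => freePot lam (p.1 - p.2) - freePot lam (p.1 + p.2))
      (uIcc a b ×ˢ uIcc c d) := by
    have hV := continuous_freePot lam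
    exact ContinuousOn.integrableOn_compact (isCompact_uIcc.prod isCompact_uIcc)
      (by fun_prop)
  refine (h3.add h4).congr_fun ?_ (measurableSet_uIcc.prod measurableSet_uIcc)
  intro p _
  simp [Function.uncurry, charPot_eq]

lemma charPot_integral_swap (hq : Integrable q) {Φ : ℝ → ℝ → ℝ}
    (hΦ : Continuous (Function.uncurry Φ)) (a b c d : ℝ) :
    ∫ σ in a..b, ∫ v in c..d, charPot lam q σ v * Φ σ v =
      ∫ v in c..d, ∫ σ in a..b, charPot lam q σ v * Φ σ v := by
  apply intervalIntegral_intervalIntegral_swap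
  have := (integrableOn_charPot (lam := lam) hq a b c d).mul_continuousOn hΦ.continuousOn
    (isCompact_uIcc.prod isCompact_uIcc)
  exact this.mono_set (prod_mono uIoc_subset_uIcc uIoc_subset_uIcc)

/-- By Fubini's theorem the double integral is a primitive, in `u`, of a continuous function. -/
lemma continuous_charPot_double_integral (hq : Integrable q) {Φ : ℝ → ℝ → ℝ}
    (hΦ : Continuous (Function.uncurry Φ)) :
    Continuous fun p : ℝ × ℝ =>
      ∫ σ in p.1..β, ∫ v in (0 : ℝ)..p.2, charPot lam q σ v * Φ σ v := by
  simp only [charPot_integral_swap hq hΦ]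
  have h1 := continuous_charPot_integral (lam := lam) (β := β) hq hΦ
  have h2 : Continuous fun p : (ℝ × ℝ) × ℝ => (p.1.1, p.2) := by fun_prop
  have h3 : Continuous (Function.uncurry fun (p : ℝ × ℝ) (v : ℝ) =>
      ∫ σ in p.1..β, charPot lam q σ v * Φ σ v) := by
    refine (h1.comp h2).congr fun p => ?_
    rfl
  exact continuous_parametric_intervalIntegral_of_continuous (a₀ := 0) h3 continuous_snd

lemma continuous_charIter (hq : Integrable q) (m : ℕ) :
    Continuous (Function.uncurry (charIter lam q β m)) := by
  induction m with
  | zero =>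
    have h := continuous_shifted_integral (β := β) hq (Φ := fun _ _ => 1) continuous_const
    have := continuous_const (y := (1 / 2 : ℝ)).mul
      (h.comp (by fun_prop : Continuous fun p : ℝ × ℝ => (p.1, (0 : ℝ))))
    refine this.congr fun p => ?_
    simp [Function.uncurry, charIter_zero]
  | succ m ih =>
    refine (continuous_charPot_double_integral (lam := lam) (β := β) hq ih).congr fun p => ?_
    simp only [Function.uncurry]
    rw [charIter_succ]

lemma continuous_charIterSlope (hq : Integrable q) (m : ℕ) :
    Continuous (Function.uncurry (charIterSlope lam q β m)) :=
  continuous_charPot_integral hq (continuous_charIter hq m)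

lemma charIter_succ_eq_integral_slope (hq : Integrable q) (m : ℕ) (τ u : ℝ) :
    charIter lam q β (m + 1) τ u = ∫ v in (0 : ℝ)..u, charIterSlope lam q β m τ v := by
  rw [charIter_succ, charPot_integral_swap hq (continuous_charIter hq m)]
  rfl

lemma hasDerivAt_charIter_succ (hq : Integrable q) (m : ℕ) (τ u : ℝ) :
    HasDerivAt (fun v => charIter lam q β (m + 1) τ v) (charIterSlope lam q β m τ u) u := by
  have hc : Continuous fun v => charIterSlope lam q β m τ v :=
    (continuous_charIterSlope hq m).comp (by fun_prop : Continuous fun v : ℝ => (τ, v))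
  have := hc.integral_hasStrictDerivAt 0 u
  refine this.hasDerivAt.congr_of_eventuallyEq (Eventually.of_forall fun v => ?_)
  exact charIter_succ_eq_integral_slope hq m τ v

lemma integral_abs_charPot_left_le (hq : Integrable q) (u a b : ℝ) :
    ∫ σ in Ι a b, |charPot lam q σ u| ≤ (∫ x, |q x|) + 2 * |lam| * |b - a| := by
  have h1 : Integrable fun σ => |q (σ - u)| := (hq.comp_sub_right u).abs
  have h2 : IntegrableOn (fun _ : ℝ => 2 * |lam|) (Ι a b) :=
    integrableOn_const (by simp [Real.volume_uIoc])
  calc ∫ σ in Ι a b, |charPot lam q σ u|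
      ≤ ∫ σ in Ι a b, (|q (σ - u)| + 2 * |lam|) := by
        refine integral_mono_of_nonneg (Eventually.of_forall fun _ => abs_nonneg _)
          (h1.integrableOn.add h2) (Eventually.of_forall fun σ => ?_)
        simp only [charPot_eq]
        refine (abs_add_le _ _).trans (add_le_add le_rfl ?_)
        refine (abs_sub _ _).trans ?_
        linarith [abs_freePot_le lam (σ - u), abs_freePot_le lam (σ + u)]
    _ = (∫ σ in Ι a b, |q (σ - u)|) + 2 * |lam| * |b - a| := by
        rw [MeasureTheory.integral_add h1.integrableOn h2]
        simp [Measure.real, Real.volume_uIoc, mul_comm]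
    _ ≤ (∫ σ, |q (σ - u)|) + 2 * |lam| * |b - a| := by
        refine add_le_add_left ?_ _
        exact setIntegral_le_integral h1 (Eventually.of_forall fun _ => abs_nonneg _)
    _ = _ := by rw [integral_sub_right_eq_self (fun x => |q x|) u]

lemma integral_abs_charPot_right_le (hq : Integrable q) (τ a b : ℝ) :
    ∫ v in Ι a b, |charPot lam q τ v| ≤ (∫ x, |q x|) + 2 * |lam| * |b - a| := by
  have h1 : Integrable fun v => |q (τ - v)| := (hq.comp_sub_left τ).abs
  have h2 : IntegrableOn (fun _ : ℝ => 2 * |lam|) (Ι a b) :=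
    integrableOn_const (by simp [Real.volume_uIoc])
  calc ∫ v in Ι a b, |charPot lam q τ v|
      ≤ ∫ v in Ι a b, (|q (τ - v)| + 2 * |lam|) := by
        refine integral_mono_of_nonneg (Eventually.of_forall fun _ => abs_nonneg _)
          (h1.integrableOn.add h2) (Eventually.of_forall fun v => ?_)
        simp only [charPot_eq]
        refine (abs_add_le _ _).trans (add_le_add le_rfl ?_)
        refine (abs_sub _ _).trans ?_
        linarith [abs_freePot_le lam (τ - v), abs_freePot_le lam (τ + v)]
    _ = (∫ v in Ι a b, |q (τ - v)|) + 2 * |lam| * |b - a| := by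
        rw [MeasureTheory.integral_add h1.integrableOn h2]
        simp [Measure.real, Real.volume_uIoc, mul_comm]
    _ ≤ (∫ v, |q (τ - v)|) + 2 * |lam| * |b - a| := by
        refine add_le_add_left ?_ _
        exact setIntegral_le_integral h1 (Eventually.of_forall fun _ => abs_nonneg _)
    _ = _ := by rw [integral_sub_left_eq_self (fun x => |q x|) volume τ]

lemma intervalIntegrable_abs_charPot_left (hq : Integrable q) (u a b : ℝ) :
    IntervalIntegrable (fun σ => |charPot lam q σ u|) volume a b := by
  simpa using (intervalIntegrable_charPot_mul (lam := lam) hq (g := fun _ => 1)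
    continuous_const u a b).abs

lemma intervalIntegrable_abs_charPot_right (hq : Integrable q) (τ a b : ℝ) :
    IntervalIntegrable (fun v => |charPot lam q τ v|) volume a b := by
  simp only [charPot_eq]
  have := continuous_freePot lam
  exact (((hq.comp_sub_left τ).intervalIntegrable).add
    (Continuous.intervalIntegrable (by fun_prop) a b)).abs

/-! ### Bounds for the Neumann series -/

lemma abs_integral_abs_pow (m : ℕ) (u : ℝ) :
    |∫ v in (0 : ℝ)..u, |v| ^ m| = |u| ^ (m + 1) / (m + 1) := by
  have key : ∀ w : ℝ, 0 ≤ w → ∫ v in (0 : ℝ)..w, |v| ^ m = w ^ (m + 1) / (m + 1) := by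
    intro w hw
    have : ∫ v in (0 : ℝ)..w, |v| ^ m = ∫ v in (0 : ℝ)..w, v ^ m := by
      refine integral_congr fun v hv => ?_
      rw [uIcc_of_le hw] at hv
      simp only [abs_of_nonneg hv.1]
    rw [this, integral_pow]
    simp
  rcases le_total 0 u with hu | hu
  · rw [key u hu, abs_of_nonneg (by positivity), abs_of_nonneg hu]
  · have h1 := integral_comp_neg (a := 0) (b := u) (fun v : ℝ => |v| ^ m)
    simp only [abs_neg, neg_zero] at h1
    rw [h1, integral_symm, key (-u) (by linarith), abs_neg, abs_of_nonpos hu]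
    exact abs_of_nonneg (div_nonneg (pow_nonneg (by linarith) _) (by positivity))

section Bounds

variable {S : Set ℝ} {h : ℝ → ℝ} {C : ℝ}

lemma abs_charIterSlope_le_of_charIter (hq : Integrable q)
    (hS : ∀ τ ∈ S, ∀ σ ∈ Ι τ β, σ ∈ S ∧ h σ ≤ h τ) (hh : ∀ τ ∈ S, 0 ≤ h τ)
    (hC : ∀ τ ∈ S, ∀ u, ∫ σ in Ι τ β, |charPot lam q σ u| ≤ C) {m : ℕ} {B : ℝ} (hB : 0 ≤ B)
    {u : ℝ} (hm : ∀ τ ∈ S, |charIter lam q β m τ u| ≤ h τ * B) {τ : ℝ} (hτ : τ ∈ S) :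
    |charIterSlope lam q β m τ u| ≤ h τ * C * B := by
  have hc : Continuous fun σ => charIter lam q β m σ u :=
    (continuous_charIter hq m).comp (by fun_prop : Continuous fun σ : ℝ => (σ, u))
  calc |charIterSlope lam q β m τ u|
      ≤ ∫ σ in Ι τ β, ‖charPot lam q σ u * charIter lam q β m σ u‖ := by
        rw [← Real.norm_eq_abs]
        exact norm_integral_le_integral_norm_uIoc
    _ ≤ ∫ σ in Ι τ β, |charPot lam q σ u| * (h τ * B) := by
        refine setIntegral_mono_on ?_ ?_ measurableSet_uIoc fun σ hσ => ?_
        · exact (intervalIntegrable_iff.1 (intervalIntegrable_charPot_mul hq hc u τ β)).norm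
        · exact (intervalIntegrable_iff.1
            (intervalIntegrable_abs_charPot_left hq u τ β)).mul_const _
        · rw [norm_mul]
          refine mul_le_mul_of_nonneg_left ?_ (norm_nonneg _)
          obtain ⟨h1, h2⟩ := hS τ hτ σ hσ
          exact (hm σ h1).trans (mul_le_mul_of_nonneg_right h2 hB)
    _ = (∫ σ in Ι τ β, |charPot lam q σ u|) * (h τ * B) := MeasureTheory.integral_mul_const _ _
    _ ≤ C * (h τ * B) := mul_le_mul_of_nonneg_right (hC τ hτ u) (mul_nonneg (hh τ hτ) hB)
    _ = h τ * C * B := by ring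

/-- The Picard iterates decay factorially, with a weight `h` which dominates the first iterate and
does not increase towards `β`. -/
lemma abs_charIter_le (hq : Integrable q)
    (hS : ∀ τ ∈ S, ∀ σ ∈ Ι τ β, σ ∈ S ∧ h σ ≤ h τ) (hC0 : 0 ≤ C)
    (hC : ∀ τ ∈ S, ∀ u, ∫ σ in Ι τ β, |charPot lam q σ u| ≤ C)
    (h0 : ∀ τ ∈ S, |1 / 2 * ∫ s in τ..β, q s| ≤ h τ) (m : ℕ) :
    ∀ τ ∈ S, ∀ u, |charIter lam q β m τ u| ≤ h τ * ((C * |u|) ^ m / m.factorial) := by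
  have hh : ∀ τ ∈ S, 0 ≤ h τ := fun τ hτ => (abs_nonneg _).trans (h0 τ hτ)
  induction m with
  | zero =>
    intro τ hτ u
    simpa [charIter_zero] using h0 τ hτ
  | succ m ih =>
    intro τ hτ u
    rw [charIter_succ_eq_integral_slope hq]
    have hsl : ∀ v, |charIterSlope lam q β m τ v| ≤ h τ * C * ((C * |v|) ^ m / m.factorial) :=
      fun v => abs_charIterSlope_le_of_charIter hq hS hh hC (by positivity)
        (fun σ hσ => ih σ hσ v) hτ
    calc |∫ v in (0 : ℝ)..u, charIterSlope lam q β m τ v|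
        ≤ |∫ v in (0 : ℝ)..u, h τ * C * (C ^ m / m.factorial) * |v| ^ m| := by
          have hci : Continuous fun v : ℝ => h τ * C * (C ^ m / m.factorial) * |v| ^ m := by
            fun_prop
          rw [← Real.norm_eq_abs]
          refine norm_integral_le_abs_of_norm_le (Eventually.of_forall fun v => ?_)
            (hci.intervalIntegrable (μ := volume) 0 u)
          refine (hsl v).trans (le_of_eq ?_)
          rw [mul_pow]
          ring
      _ = h τ * ((C * |u|) ^ (m + 1) / (m + 1).factorial) := by
          rw [intervalIntegral.integral_const_mul, abs_mul, abs_integral_abs_pow,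
            abs_of_nonneg (mul_nonneg (mul_nonneg (hh τ hτ) hC0) (by positivity)),
            Nat.factorial_succ, mul_pow, pow_succ C]
          push_cast
          field_simp

lemma abs_charIterSlope_le (hq : Integrable q)
    (hS : ∀ τ ∈ S, ∀ σ ∈ Ι τ β, σ ∈ S ∧ h σ ≤ h τ) (hC0 : 0 ≤ C)
    (hC : ∀ τ ∈ S, ∀ u, ∫ σ in Ι τ β, |charPot lam q σ u| ≤ C)
    (h0 : ∀ τ ∈ S, |1 / 2 * ∫ s in τ..β, q s| ≤ h τ) (m : ℕ) {τ : ℝ} (hτ : τ ∈ S) (u : ℝ) :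
    |charIterSlope lam q β m τ u| ≤ h τ * C * ((C * |u|) ^ m / m.factorial) :=
  abs_charIterSlope_le_of_charIter hq hS (fun τ hτ => (abs_nonneg _).trans (h0 τ hτ)) hC
    (by positivity) (fun σ hσ => abs_charIter_le hq hS hC0 hC h0 m σ hσ u) hτ

end Bounds

/-- The transformation kernel in characteristic coordinates. -/
def charKernel (lam : ℝ) (q : ℝ → ℝ) (β τ u : ℝ) : ℝ := ∑' m, charIter lam q β m τ u

/-- The derivative of the kernel in the second characteristic coordinate. -/
def charKernelSlope (lam : ℝ) (q : ℝ → ℝ) (β τ u : ℝ) : ℝ := ∑' m, charIterSlope lam q β m τ u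

lemma kernelPlus_eq (x t : ℝ) :
    kernelPlus lam q β x t = charKernel lam q β ((x + t) / 2) ((t - x) / 2) := by
  have h1 : (x + t) / 2 - (t - x) / 2 = x := by ring
  have h2 : (x + t) / 2 + (t - x) / 2 = t := by ring
  simp only [kernelPlus, charKernel, charIter, h1, h2]

lemma exists_summable_bound (hq : Integrable q) (L : ℝ) :
    ∃ b : ℕ → ℝ, Summable b ∧ ∀ m τ u, |τ| ≤ L → |u| ≤ L →
      |charIter lam q β m τ u| ≤ b m ∧ |charIterSlope lam q β m τ u| ≤ b m := by
  wlog hL : |β| ≤ L generalizing L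
  · obtain ⟨b, hb, h⟩ := this |β| le_rfl
    have hL' := (not_le.1 hL).le
    exact ⟨b, hb, fun m τ u h1 h2 => h m τ u (h1.trans hL') (h2.trans hL')⟩
  set A := ∫ x, |q x| with hA
  have hA0 : 0 ≤ A := integral_nonneg fun _ => abs_nonneg _
  have hL0 : 0 ≤ L := (abs_nonneg _).trans hL
  set C := A + 2 * |lam| * (2 * L) with hCdef
  have hC0 : 0 ≤ C := by positivity
  set S := {τ : ℝ | |τ| ≤ L} with hSdef
  have hS : ∀ τ ∈ S, ∀ σ ∈ Ι τ β, σ ∈ S ∧ (fun _ => A : ℝ → ℝ) σ ≤ (fun _ => A : ℝ → ℝ) τ := by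
    intro τ hτ σ hσ
    refine ⟨?_, le_rfl⟩
    have h1 : S = Icc (-L) L := by
      ext
      simp [hSdef, abs_le]
    have h2 := uIoc_subset_uIcc hσ
    rw [h1] at hτ ⊢
    exact (ordConnected_Icc.uIcc_subset hτ (abs_le.1 hL)) h2
  have hC : ∀ τ ∈ S, ∀ u, ∫ σ in Ι τ β, |charPot lam q σ u| ≤ C := by
    intro τ hτ u
    refine (integral_abs_charPot_left_le hq u τ β).trans ?_
    have : |β - τ| ≤ 2 * L := (abs_sub _ _).trans (by linarith [show |τ| ≤ L from hτ])
    rw [hCdef]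
    gcongr
  have h0 : ∀ τ ∈ S, |1 / 2 * ∫ s in τ..β, q s| ≤ (fun _ => A : ℝ → ℝ) τ := by
    intro τ _
    have h1 : |∫ s in τ..β, q s| ≤ A := by
      refine (norm_integral_le_integral_norm_uIoc (f := q)).trans ?_
      exact setIntegral_le_integral hq.norm (Eventually.of_forall fun _ => norm_nonneg _)
    rw [abs_mul, abs_of_pos (by norm_num : (0 : ℝ) < 1 / 2)]
    simp only
    linarith [abs_nonneg (∫ s in τ..β, q s)]
  refine ⟨fun m => A * (1 + C) * ((C * L) ^ m / m.factorial),
    (Real.summable_pow_div_factorial (C * L)).mul_left _, fun m τ u hτ hu => ⟨?_, ?_⟩⟩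
  · refine (abs_charIter_le hq hS hC0 hC h0 m τ hτ u).trans ?_
    simp only
    gcongr
    nlinarith
  · refine (abs_charIterSlope_le hq hS hC0 hC h0 m hτ u).trans ?_
    simp only
    gcongr
    nlinarith

lemma summable_charIter (hq : Integrable q) (τ u : ℝ) :
    Summable fun m => charIter lam q β m τ u := by
  obtain ⟨b, hb, h⟩ := exists_summable_bound (lam := lam) (β := β) hq (max |τ| |u|)
  exact hb.of_norm_bounded fun m => (h m τ u (le_max_left _ _) (le_max_right _ _)).1

lemma continuous_uncurry_of_local {f : ℝ → ℝ → ℝ}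
    (h : ∀ L, ContinuousOn (Function.uncurry f) (Ioo (-L) L ×ˢ Ioo (-L) L)) :
    Continuous (Function.uncurry f) := by
  refine continuous_iff_continuousAt.2 fun ⟨τ, u⟩ => ?_
  refine (h (max |τ| |u| + 1)).continuousAt
    (prod_mem_nhds (Ioo_mem_nhds ?_ ?_) (Ioo_mem_nhds ?_ ?_))
  · linarith [le_max_left |τ| |u|, neg_abs_le τ]
  · linarith [le_max_left |τ| |u|, le_abs_self τ]
  · linarith [le_max_right |τ| |u|, neg_abs_le u]
  · linarith [le_max_right |τ| |u|, le_abs_self u]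

lemma continuous_charKernel (hq : Integrable q) :
    Continuous (Function.uncurry (charKernel lam q β)) := by
  refine continuous_uncurry_of_local fun L => ?_
  obtain ⟨b, hb, h⟩ := exists_summable_bound (lam := lam) (β := β) hq L
  exact continuousOn_tsum (f := fun m (p : ℝ × ℝ) => charIter lam q β m p.1 p.2)
    (fun m => (continuous_charIter hq m).continuousOn) hb fun m p hp =>
      (h m p.1 p.2 (abs_le.2 ⟨hp.1.1.le, hp.1.2.le⟩) (abs_le.2 ⟨hp.2.1.le, hp.2.2.le⟩)).1

lemma continuous_charKernelSlope (hq : Integrable q) :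
    Continuous (Function.uncurry (charKernelSlope lam q β)) := by
  refine continuous_uncurry_of_local fun L => ?_
  obtain ⟨b, hb, h⟩ := exists_summable_bound (lam := lam) (β := β) hq L
  exact continuousOn_tsum (f := fun m (p : ℝ × ℝ) => charIterSlope lam q β m p.1 p.2)
    (fun m => (continuous_charIterSlope hq m).continuousOn) hb fun m p hp =>
      (h m p.1 p.2 (abs_le.2 ⟨hp.1.1.le, hp.1.2.le⟩) (abs_le.2 ⟨hp.2.1.le, hp.2.2.le⟩)).2

lemma hasDerivAt_charKernel (hq : Integrable q) (τ u : ℝ) :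
    HasDerivAt (fun v => charKernel lam q β τ v) (charKernelSlope lam q β τ u) u := by
  set L := max |τ| |u| + 1
  obtain ⟨b, hb, h⟩ := exists_summable_bound (lam := lam) (β := β) hq L
  have hτL : |τ| ≤ L := (le_max_left _ _).trans (by linarith)
  have huL : |u| < L := (le_max_right _ _).trans_lt (by linarith)
  have hsum := hasDerivAt_tsum_of_isPreconnected (t := Ioo (-L) L) (u := fun m => b m)
    (g := fun m v => charIter lam q β (m + 1) τ v)
    (g' := fun m v => charIterSlope lam q β m τ v) hb isOpen_Ioo isPreconnected_Ioo
    (fun m v _ => hasDerivAt_charIter_succ hq m τ v)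
    (fun m v hv => (h m τ v hτL (abs_le.2 ⟨hv.1.le, hv.2.le⟩)).2) (abs_lt.1 huL)
    ((summable_nat_add_iff 1).2 (summable_charIter hq τ u)) (abs_lt.1 huL)
  refine (hsum.const_add (1 / 2 * ∫ s in τ..β, q s)).congr_of_eventuallyEq
    (Eventually.of_forall fun v => ?_)
  simp only [charKernel]
  rw [(summable_charIter hq τ v).tsum_eq_zero_add, charIter_zero]

/-- If the first Picard iterate is `O((β - τ) ^ P)`, then so are the kernel and its slope, and the
kernel differs from the first iterate by `O((β - τ) ^ (P + 1))`. -/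
lemma exists_charKernel_bound (hq : Integrable q) {A : ℝ} {P : ℕ}
    (hA : ∀ τ ∈ Icc 0 β, |1 / 2 * ∫ s in τ..β, q s| ≤ A * (β - τ) ^ P) :
    ∃ D, ∀ τ ∈ Icc 0 β, ∀ u ∈ Icc 0 β,
      |charKernelSlope lam q β τ u| ≤ D * (β - τ) ^ P ∧
      |charKernel lam q β τ u - 1 / 2 * ∫ s in τ..β, q s| ≤ D * (β - τ) ^ (P + 1) := by
  rcases lt_or_ge β 0 with hβ | hβ
  · exact ⟨0, fun τ hτ => absurd (hτ.1.trans hτ.2) (not_le.2 hβ)⟩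
  set C := (∫ x, |q x|) + 2 * |lam| * β with hCdef
  have hC0 : 0 ≤ C := add_nonneg (integral_nonneg fun _ => abs_nonneg _) (by positivity)
  set h : ℝ → ℝ := fun τ => |A| * (β - τ) ^ P with hh
  have hS : ∀ τ ∈ Icc 0 β, ∀ σ ∈ Ι τ β, σ ∈ Icc 0 β ∧ h σ ≤ h τ := by
    intro τ hτ σ hσ
    rw [uIoc_of_le hτ.2] at hσ
    refine ⟨⟨hτ.1.trans hσ.1.le, hσ.2⟩, ?_⟩
    have h1 := hσ.1.le
    have h2 := hσ.2
    simp only [hh]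
    gcongr
  have hC : ∀ τ ∈ Icc 0 β, ∀ u, ∫ σ in Ι τ β, |charPot lam q σ u| ≤ C := by
    intro τ hτ u
    refine (integral_abs_charPot_left_le hq u τ β).trans ?_
    have : |β - τ| ≤ β := by
      rw [abs_of_nonneg (by linarith [hτ.2])]
      linarith [hτ.1]
    rw [hCdef]
    gcongr
  have h0 : ∀ τ ∈ Icc 0 β, |1 / 2 * ∫ s in τ..β, q s| ≤ h τ := fun τ hτ =>
    (hA τ hτ).trans (mul_le_mul_of_nonneg_right (le_abs_self A)
      (pow_nonneg (by linarith [hτ.2]) _))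
  have hpos : ∀ τ ∈ Icc 0 β, 0 ≤ (β - τ) ^ P := fun τ hτ => pow_nonneg (by linarith [hτ.2]) _
  have hexp : HasSum (fun m : ℕ => (C * β) ^ m / m.factorial) (Real.exp (C * β)) := by
    rw [Real.exp_eq_exp_ℝ]
    exact NormedSpace.expSeries_div_hasSum_exp (C * β)
  refine ⟨|A| * C * Real.exp (C * β), fun τ hτ u hu => ⟨?_, ?_⟩⟩
  · have hb : ∀ m, ‖charIterSlope lam q β m τ u‖ ≤ h τ * C * ((C * β) ^ m / m.factorial) := by
      intro m
      refine (abs_charIterSlope_le hq hS hC0 hC h0 m hτ u).trans ?_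
      have := hpos τ hτ
      simp only [hh]
      rw [abs_of_nonneg hu.1]
      have := hu.1
      have := hu.2
      gcongr
    have := tsum_of_norm_bounded (hexp.mul_left (h τ * C)) hb
    refine this.trans (le_of_eq ?_)
    simp only [hh]
    ring
  · -- Integrating over `v` first bounds the inner integral, so that the outer one gains `β - τ`.
    have hb : ∀ m, ‖charIter lam q β (m + 1) τ u‖ ≤
        h τ * C * (β - τ) * ((C * β) ^ m / m.factorial) := by
      intro m
      rw [charIter_succ]
      have hin : ∀ σ ∈ Ι τ β, ‖∫ v in (0 : ℝ)..u, charPot lam q σ v * charIter lam q β m σ v‖ ≤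
          h τ * C * ((C * β) ^ m / m.factorial) := by
        intro σ hσ
        obtain ⟨hσS, hσh⟩ := hS τ hτ σ hσ
        have hcI : Continuous fun v => charIter lam q β m σ v :=
          (continuous_charIter hq m).comp (by fun_prop : Continuous fun v : ℝ => (σ, v))
        have hB0 : 0 ≤ h τ * ((C * β) ^ m / m.factorial) :=
          mul_nonneg ((abs_nonneg _).trans (h0 τ hτ)) (by positivity)
        have hle : ∀ v ∈ Ioc 0 u, ‖charPot lam q σ v * charIter lam q β m σ v‖ ≤
            |charPot lam q σ v| * (h τ * ((C * β) ^ m / m.factorial)) := by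
          intro v hv
          rw [norm_mul]
          refine mul_le_mul_of_nonneg_left ?_ (norm_nonneg _)
          refine (abs_charIter_le hq hS hC0 hC h0 m σ hσS v).trans ?_
          rw [abs_of_pos hv.1]
          have h1 : v ≤ β := hv.2.trans hu.2
          have h2 := hv.1.le
          have h3 : 0 ≤ h τ := (abs_nonneg _).trans (h0 τ hτ)
          gcongr
        refine (norm_integral_le_of_norm_le hu.1 (Eventually.of_forall hle)
          ((intervalIntegrable_abs_charPot_right hq σ 0 u).mul_const _)).trans ?_
        rw [intervalIntegral.integral_mul_const, integral_of_le hu.1]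
        have h4 := integral_abs_charPot_right_le (lam := lam) hq σ 0 u
        rw [uIoc_of_le hu.1, sub_zero, abs_of_nonneg hu.1] at h4
        have h5 : 2 * |lam| * u ≤ 2 * |lam| * β := mul_le_mul_of_nonneg_left hu.2 (by positivity)
        calc _ ≤ C * (h τ * ((C * β) ^ m / m.factorial)) :=
              mul_le_mul_of_nonneg_right (by linarith) hB0
          _ = _ := by ring
      refine (norm_integral_le_of_norm_le_const hin).trans (le_of_eq ?_)
      rw [abs_of_nonneg (by linarith [hτ.2])]
      ring
    have h1 : charKernel lam q β τ u - 1 / 2 * ∫ s in τ..β, q s =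
        ∑' m, charIter lam q β (m + 1) τ u := by
      rw [charKernel, (summable_charIter hq τ u).tsum_eq_zero_add, charIter_zero]
      ring
    rw [h1]
    have := tsum_of_norm_bounded (hexp.mul_left (h τ * C * (β - τ))) hb
    refine this.trans (le_of_eq ?_)
    simp only [hh]
    ring

/-! ### Differentiation of the transformation operator -/

/-- Leibniz's rule at `0` for an integral whose lower end point is the parameter. -/
lemma hasDerivAt_integral_lower_param {Ψ Ψ' : ℝ → ℝ → ℂ} (hΨ : Continuous (Function.uncurry Ψ))
    (hΨ' : Continuous (Function.uncurry Ψ')) (hd : ∀ x τ, HasDerivAt (fun y => Ψ y τ) (Ψ' x τ) x)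
    (b : ℝ) :
    HasDerivAt (fun x => ∫ τ in x..b, Ψ x τ) ((∫ τ in (0 : ℝ)..b, Ψ' 0 τ) - Ψ 0 0) 0 := by
  have hsec : ∀ x, Continuous fun τ => Ψ x τ := fun x =>
    hΨ.comp (by fun_prop : Continuous fun τ : ℝ => (x, τ))
  have hsec' : ∀ x, Continuous fun τ => Ψ' x τ := fun x =>
    hΨ'.comp (by fun_prop : Continuous fun τ : ℝ => (x, τ))
  have h1 : HasDerivAt (fun x => ∫ τ in (0 : ℝ)..b, Ψ x τ) (∫ τ in (0 : ℝ)..b, Ψ' 0 τ) 0 := by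
    obtain ⟨C, hC⟩ := (isCompact_Icc.prod isCompact_uIcc :
      IsCompact (Icc (-1 : ℝ) 1 ×ˢ uIcc 0 b)).exists_bound_of_continuousOn hΨ'.continuousOn
    refine (hasDerivAt_integral_of_dominated_loc_of_deriv_le (F := Ψ) (F' := Ψ')
      (bound := fun _ => C) (Icc_mem_nhds (by norm_num) (by norm_num) : Icc (-1 : ℝ) 1 ∈ 𝓝 0)
      (Eventually.of_forall fun x => (hsec x).aestronglyMeasurable)
      ((hsec 0).intervalIntegrable _ _) (hsec' 0).aestronglyMeasurable
      (Eventually.of_forall fun τ hτ x hx => hC (x, τ) ⟨hx, uIoc_subset_uIcc hτ⟩)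
      intervalIntegrable_const (Eventually.of_forall fun τ _ x _ => hd x τ)).2
  -- After rescaling, the integral over `[0, x]` is `x` times a continuous function of `x`.
  have h2 : HasDerivAt (fun x => ∫ τ in (0 : ℝ)..x, Ψ x τ) (Ψ 0 0) 0 := by
    have hc : Continuous fun x : ℝ => ∫ s in (0 : ℝ)..1, Ψ x (x * s) := by
      refine continuous_parametric_intervalIntegral_of_continuous' ?_ 0 1
      exact hΨ.comp (by fun_prop : Continuous fun p : ℝ × ℝ => (p.1, p.1 * p.2))
    have he : (fun x => ∫ τ in (0 : ℝ)..x, Ψ x τ) =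
        fun x : ℝ => x • ∫ s in (0 : ℝ)..1, Ψ x (x * s) := by
      ext x
      rw [smul_integral_comp_mul_left]
      simp
    rw [he, hasDerivAt_iff_tendsto_slope]
    have h3 : Tendsto (fun x : ℝ => ∫ s in (0 : ℝ)..1, Ψ x (x * s)) (𝓝[≠] 0) (𝓝 (Ψ 0 0)) := by
      have := (hc.tendsto 0).mono_left (nhdsWithin_le_nhds (s := {0}ᶜ))
      simpa using this
    refine h3.congr' ?_
    filter_upwards [self_mem_nhdsWithin] with x hx
    rw [slope_def_module]
    simp only [zero_smul, sub_zero]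
    rw [smul_smul, inv_mul_cancel₀ hx, one_smul]
  refine (h1.sub h2).congr_of_eventuallyEq (Eventually.of_forall fun x => ?_)
  exact (integral_interval_sub_left ((hsec x).intervalIntegrable _ _)
    ((hsec x).intervalIntegrable _ _)).symm

lemma continuous_shear {g : ℝ → ℝ → ℝ} (hg : Continuous (Function.uncurry g)) :
    Continuous fun p : ℝ × ℝ => g p.2 (p.2 - p.1) :=
  hg.comp (by fun_prop : Continuous fun p : ℝ × ℝ => (p.2, p.2 - p.1))

lemma continuous_diag {g : ℝ → ℝ → ℝ} (hg : Continuous (Function.uncurry g)) :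
    Continuous fun τ : ℝ => g τ τ :=
  hg.comp (by fun_prop : Continuous fun τ : ℝ => (τ, τ))

lemma integral_kernelPlus_mul (f : ℝ → ℂ) (x : ℝ) :
    ∫ t in x..(2 * β - x), ((kernelPlus lam q β x t : ℝ) : ℂ) * f t =
      2 * ∫ τ in x..β, ((charKernel lam q β τ (τ - x) : ℝ) : ℂ) * f (2 * τ - x) := by
  have h := integral_comp_mul_sub (a := x) (b := β)
    (fun t => ((kernelPlus lam q β x t : ℝ) : ℂ) * f t) (two_ne_zero (α := ℝ)) x
  have e : 2 * x - x = x := by ring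
  rw [e] at h
  have h2 : ∀ τ : ℝ, ((kernelPlus lam q β x (2 * τ - x) : ℝ) : ℂ) =
      ((charKernel lam q β τ (τ - x) : ℝ) : ℂ) := by
    intro τ
    rw [kernelPlus_eq]
    congr 2 <;> ring
  simp only [h2] at h
  rw [h, Complex.real_smul]
  push_cast
  ring

/-- In characteristic coordinates the parameter `x` enters the kernel only through `u`, in which it
is differentiable; hence the transformation operator can be differentiated although `q` is merely
integrable. -/
lemma hasDerivAt_integral_kernelPlus_mul (hq : Integrable q) {f f' : ℝ → ℂ}
    (hf : ∀ x, HasDerivAt f (f' x) x) (hf' : Continuous f') :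
    HasDerivAt (fun x => ∫ t in x..(2 * β - x), ((kernelPlus lam q β x t : ℝ) : ℂ) * f t)
      (-2 * ((∫ τ in (0 : ℝ)..β, ((charKernelSlope lam q β τ τ : ℝ) : ℂ) * f (2 * τ)) +
        (∫ τ in (0 : ℝ)..β, ((charKernel lam q β τ τ : ℝ) : ℂ) * f' (2 * τ)) +
        ((charKernel lam q β 0 0 : ℝ) : ℂ) * f 0)) 0 := by
  have hfc : Continuous f := continuous_iff_continuousAt.2 fun x => (hf x).continuousAt
  have hK := continuous_charKernel (lam := lam) (β := β) hq
  have hG := continuous_charKernelSlope (lam := lam) (β := β) hq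
  have hK2 : Continuous fun p : ℝ × ℝ => charKernel lam q β p.2 (p.2 - p.1) :=
    continuous_shear hK
  have hG2 : Continuous fun p : ℝ × ℝ => charKernelSlope lam q β p.2 (p.2 - p.1) :=
    continuous_shear hG
  have key := (hasDerivAt_integral_lower_param
    (Ψ := fun x τ => ((charKernel lam q β τ (τ - x) : ℝ) : ℂ) * f (2 * τ - x))
    (Ψ' := fun x τ => -((charKernelSlope lam q β τ (τ - x) : ℝ) : ℂ) * f (2 * τ - x) +
      ((charKernel lam q β τ (τ - x) : ℝ) : ℂ) * -f' (2 * τ - x)) ?_ ?_ ?_ β).const_mul 2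
  · simp only [integral_kernelPlus_mul]
    refine key.congr_deriv ?_
    have hK0 : Continuous fun τ => charKernel lam q β τ τ :=
      continuous_diag hK
    have hG0 : Continuous fun τ => charKernelSlope lam q β τ τ :=
      continuous_diag hG
    simp only [sub_zero, mul_zero, neg_mul, mul_neg]
    rw [intervalIntegral.integral_add, intervalIntegral.integral_neg,
      intervalIntegral.integral_neg]
    · ring
    · exact (by fun_prop : Continuous fun τ : ℝ =>
        -(((charKernelSlope lam q β τ τ : ℝ) : ℂ) * f (2 * τ))).intervalIntegrable _ _
    · exact (by fun_prop : Continuous fun τ : ℝ =>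
        -(((charKernel lam q β τ τ : ℝ) : ℂ) * f' (2 * τ))).intervalIntegrable _ _
  · exact (by fun_prop : Continuous fun p : ℝ × ℝ =>
      ((charKernel lam q β p.2 (p.2 - p.1) : ℝ) : ℂ) * f (2 * p.2 - p.1))
  · exact (by fun_prop : Continuous fun p : ℝ × ℝ =>
      -((charKernelSlope lam q β p.2 (p.2 - p.1) : ℝ) : ℂ) * f (2 * p.2 - p.1) +
      ((charKernel lam q β p.2 (p.2 - p.1) : ℝ) : ℂ) * -f' (2 * p.2 - p.1))
  · intro x τ
    have h1 : HasDerivAt (fun y : ℝ => τ - y) (-1) x := by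
      simpa using (hasDerivAt_id x).const_sub τ
    have h2 : HasDerivAt (fun y : ℝ => 2 * τ - y) (-1) x := by
      simpa using (hasDerivAt_id x).const_sub (2 * τ)
    have h3 := ((hasDerivAt_charKernel (lam := lam) (β := β) hq τ (τ - x)).comp x h1).ofReal_comp
    have h4 := (hf (2 * τ - x)).scomp x h2
    simp only [Function.comp_def, mul_neg, mul_one, neg_smul, one_smul, Complex.ofReal_neg]
      at h3 h4
    exact h3.mul h4

/-! ### Vanishing order of the potential and of the kernel at the edge of the support -/

/-- A function with a bounded derivative to the left of `a` has a limit from the left at `a`. -/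
lemma exists_tendsto_nhdsLT_of_tendsto_deriv {g : ℝ → ℝ} {a l : ℝ}
    (hd : ∀ᶠ x in 𝓝[<] a, DifferentiableAt ℝ g x) (hl : Tendsto (deriv g) (𝓝[<] a) (𝓝 l)) :
    ∃ L, Tendsto g (𝓝[<] a) (𝓝 L) := by
  have hb : ∀ᶠ x in 𝓝[<] a, ‖deriv g x‖₊ ≤ ‖l‖₊ + 1 := by
    filter_upwards [hl.nnnorm.eventually (gt_mem_nhds (lt_add_of_pos_right _ one_pos))]
      with x hx using hx.le
  obtain ⟨b, hba, hb⟩ := (mem_nhdsLT_iff_exists_Ioo_subset).1 (hd.and hb)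
  have hlip : LipschitzOnWith (‖l‖₊ + 1) g (Ioo b a) :=
    (convex_Ioo b a).lipschitzOnWith_of_nnnorm_deriv_le (fun x hx => (hb hx).1)
      (fun x hx => (hb hx).2)
  obtain ⟨g', hg', heq⟩ := hlip.extend_real
  refine ⟨g' a, ((hg'.continuous.tendsto a).mono_left nhdsWithin_le_nhds).congr' ?_⟩
  filter_upwards [Ioo_mem_nhdsLT hba] with x hx using (heq hx).symm

/-- If some derivative of `g` has a nonzero limit from the left at `a`, then `g` is, to the left of
`a`, equivalent to a nonzero multiple of a power of `a - x`. The exponent is the order of the first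
derivative whose one-sided limit does not vanish. -/
lemma exists_order_of_tendsto_iteratedDeriv {a l : ℝ} (hl : l ≠ 0) (k : ℕ) :
    ∀ g : ℝ → ℝ, (∀ j < k, ∀ᶠ x in 𝓝[<] a, DifferentiableAt ℝ (iteratedDeriv j g) x) →
      Tendsto (iteratedDeriv k g) (𝓝[<] a) (𝓝 l) →
      ∃ j : ℕ, ∃ c ≠ 0, Tendsto (fun x => g x / (a - x) ^ j) (𝓝[<] a) (𝓝 c) := by
  induction k with
  | zero =>
    intro g _ hg
    exact ⟨0, l, hl, by simpa using hg⟩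
  | succ k ih =>
    intro g hd hg
    obtain ⟨j, c, hc, hj⟩ := ih (deriv g)
      (fun i hi => by simpa only [← iteratedDeriv_succ'] using hd (i + 1) (by omega))
      (by simpa only [← iteratedDeriv_succ'] using hg)
    have hdg : ∀ᶠ x in 𝓝[<] a, DifferentiableAt ℝ g x := by
      simpa using hd 0 (Nat.succ_pos k)
    have hne : ∀ᶠ x in 𝓝[<] a, a - x ≠ 0 := by
      filter_upwards [self_mem_nhdsWithin] with x hx using (sub_pos.2 hx).ne'
    have hlim : Tendsto (fun x => a - x) (𝓝[<] a) (𝓝 0) := by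
      have : Tendsto (fun x => a - x) (𝓝 a) (𝓝 (a - a)) := tendsto_const_nhds.sub tendsto_id
      rw [sub_self] at this
      exact this.mono_left nhdsWithin_le_nhds
    have hderiv : Tendsto (deriv g) (𝓝[<] a) (𝓝 (c * 0 ^ j)) := by
      refine (hj.mul (hlim.pow j)).congr' ?_
      filter_upwards [hne] with x hx
      field_simp
    obtain ⟨L, hL⟩ := exists_tendsto_nhdsLT_of_tendsto_deriv hdg hderiv
    by_cases hL0 : L = 0
    · subst hL0
      refine ⟨j + 1, -c / (j + 1), div_ne_zero (neg_ne_zero.2 hc) (by positivity), ?_⟩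
      refine HasDerivAt.lhopital_zero_nhdsLT (f' := deriv g)
        (g' := fun x => -((j + 1 : ℝ) * (a - x) ^ j)) ?_ ?_ ?_ hL ?_ ?_
      · filter_upwards [hdg] with x hx using hx.hasDerivAt
      · refine Eventually.of_forall fun x => ?_
        have := ((hasDerivAt_id x).const_sub a).fun_pow (j + 1)
        simpa using this
      · filter_upwards [hne] with x hx
        exact neg_ne_zero.2 (mul_ne_zero (by positivity) (pow_ne_zero _ hx))
      · simpa using hlim.pow (j + 1)
      · have h1 := (hj.neg).div_const (j + 1 : ℝ)
        refine h1.congr' ?_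
        filter_upwards [hne] with x hx
        field_simp
    · exact ⟨0, L, hL0, by simpa using hL⟩

lemma exists_order_of_derivJumpAt {k : ℕ} (hq0 : ∀ x, β < x → q x = 0) (h : DerivJumpAt k q β) :
    ∃ j : ℕ, ∃ c ≠ 0, Tendsto (fun x => q x / (β - x) ^ j) (𝓝[<] β) (𝓝 c) := by
  obtain ⟨hd, l, r, hlr, hl, hr⟩ := h
  have hr0 : r = 0 := by
    refine tendsto_nhds_unique (hr.congr' ?_) tendsto_const_nhds
    filter_upwards [self_mem_nhdsWithin] with x hx
    have : q =ᶠ[𝓝 x] fun _ => 0 := by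
      filter_upwards [Ioi_mem_nhds hx] with y hy using hq0 y hy
    rw [this.iteratedDeriv_eq]
    simp
  subst hr0
  exact exists_order_of_tendsto_iteratedDeriv hlr k q
    (fun j hj => (hd j hj).filter_mono (nhdsWithin_mono _ fun x hx => ne_of_lt hx)) hl

lemma integral_sub_pow (j : ℕ) (τ : ℝ) :
    ∫ s in τ..β, (β - s) ^ j = (β - τ) ^ (j + 1) / (j + 1) := by
  rw [integral_comp_sub_left (fun s => s ^ j) β]
  simp [integral_pow]

lemma tendsto_integral_div_pow (hq : Integrable q) {j : ℕ} {c : ℝ}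
    (h : Tendsto (fun x => q x / (β - x) ^ j) (𝓝[<] β) (𝓝 c)) :
    Tendsto (fun τ => (1 / 2 * ∫ s in τ..β, q s) / (β - τ) ^ (j + 1)) (𝓝[<] β)
      (𝓝 (c / (2 * (j + 1)))) := by
  rw [Metric.tendsto_nhds]
  intro ε hε
  obtain ⟨b, hb, hsub⟩ := (mem_nhdsLT_iff_exists_Ioo_subset).1 (Metric.tendsto_nhds.1 h ε hε)
  filter_upwards [Ioo_mem_nhdsLT hb] with τ hτ
  have hpos : 0 < β - τ := sub_pos.2 hτ.2
  have h1 : |∫ s in τ..β, (q s - c * (β - s) ^ j)| ≤ ∫ s in τ..β, ε * (β - s) ^ j := by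
    rw [← Real.norm_eq_abs]
    refine norm_integral_le_of_norm_le hτ.2.le ?_
      (Continuous.intervalIntegrable (by fun_prop : Continuous fun s : ℝ => ε * (β - s) ^ j) _ _)
    have hne : ∀ᵐ s : ℝ, s ≠ β := by simp [ae_iff]
    filter_upwards [hne] with s hsβ hs
    have hs' : s < β := lt_of_le_of_ne hs.2 hsβ
    have h2 := hsub ⟨hτ.1.trans hs.1, hs'⟩
    have hp : 0 < (β - s) ^ j := pow_pos (sub_pos.2 hs') j
    simp only [mem_ofPred_eq, Real.dist_eq] at h2
    have h3 : q s - c * (β - s) ^ j = (q s / (β - s) ^ j - c) * (β - s) ^ j := by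
      field_simp
    rw [h3, norm_mul, Real.norm_eq_abs, Real.norm_eq_abs, abs_of_pos hp]
    exact mul_le_mul_of_nonneg_right h2.le hp.le
  rw [intervalIntegral.integral_sub hq.intervalIntegrable
    (Continuous.intervalIntegrable (by fun_prop) _ _), intervalIntegral.integral_const_mul,
    intervalIntegral.integral_const_mul, integral_sub_pow] at h1
  have hp : 0 < (β - τ) ^ (j + 1) := pow_pos hpos _
  rw [Real.dist_eq]
  have h4 : (1 / 2 * ∫ s in τ..β, q s) / (β - τ) ^ (j + 1) - c / (2 * (j + 1)) =
      ((∫ s in τ..β, q s) - c * ((β - τ) ^ (j + 1) / (j + 1))) / (2 * (β - τ) ^ (j + 1)) := by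
    field_simp
  rw [h4, abs_div, abs_of_pos (by positivity : 0 < 2 * (β - τ) ^ (j + 1)),
    div_lt_iff₀ (by positivity)]
  refine h1.trans_lt ?_
  have h5 : (β - τ) ^ (j + 1) / (j + 1) ≤ (β - τ) ^ (j + 1) :=
    div_le_self hp.le (by linarith [Nat.cast_nonneg (α := ℝ) j])
  nlinarith [mul_pos hε hp, mul_le_mul_of_nonneg_left h5 hε.le]

/-- If `f / (β - τ) ^ P` has a limit at `β` and `f` is bounded, then `f = O((β - τ) ^ P)`. -/
lemma exists_bound_of_tendsto_div_pow {f : ℝ → ℝ} {P : ℕ} {c B : ℝ} (hB : ∀ τ, |f τ| ≤ B)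
    (hf : f β = 0) (h : Tendsto (fun τ => f τ / (β - τ) ^ P) (𝓝[<] β) (𝓝 c)) :
    ∃ A, ∀ τ ∈ Icc 0 β, |f τ| ≤ A * (β - τ) ^ P := by
  obtain ⟨b, hb, hsub⟩ := (mem_nhdsLT_iff_exists_Ioo_subset).1
    (Metric.tendsto_nhds.1 h 1 one_pos)
  have hb' : 0 < β - b := sub_pos.2 hb
  have hB0 : 0 ≤ B := (abs_nonneg _).trans (hB 0)
  refine ⟨|c| + 1 + B / (β - b) ^ P, fun τ hτ => ?_⟩
  have h0 : 0 ≤ (β - τ) ^ P := pow_nonneg (sub_nonneg.2 hτ.2) _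
  have hBb : 0 ≤ B / (β - b) ^ P := by positivity
  rcases eq_or_lt_of_le hτ.2 with rfl | hτβ
  · rw [hf, abs_zero]
    positivity
  rcases le_or_gt τ b with hτb | hτb
  · have h1 : (β - b) ^ P ≤ (β - τ) ^ P := by gcongr
    calc |f τ| ≤ B := hB τ
      _ = B / (β - b) ^ P * (β - b) ^ P := by field_simp
      _ ≤ B / (β - b) ^ P * (β - τ) ^ P := by gcongr
      _ ≤ _ := by
        gcongr
        linarith [abs_nonneg c]
  · have hp : 0 < (β - τ) ^ P := pow_pos (sub_pos.2 hτβ) _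
    have h1 := hsub ⟨hτb, hτβ⟩
    simp only [mem_ofPred_eq, Real.dist_eq] at h1
    have h2 : |f τ / (β - τ) ^ P| ≤ |c| + 1 := by
      have := abs_sub_abs_le_abs_sub (f τ / (β - τ) ^ P) c
      linarith
    rw [abs_div, abs_of_pos hp, div_le_iff₀ hp] at h2
    exact h2.trans (mul_le_mul_of_nonneg_right (by linarith) h0)

/-- The kernel on the characteristic `x = 0` vanishes at `β` exactly to some order `P + 1`, and its
slope vanishes at least to the same order. -/
lemma exists_charKernel_asymptotics (hq : Integrable q) (hq0 : ∀ x, β < x → q x = 0) (hβ : 0 < β)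
    {k : ℕ} (hjump : DerivJumpAt k q β) :
    ∃ P : ℕ, ∃ c ≠ 0, ∃ D,
      Tendsto (fun τ => charKernel lam q β τ τ / (β - τ) ^ (P + 1)) (𝓝[<] β) (𝓝 c) ∧
      ∀ τ ∈ Icc 0 β, |charKernel lam q β τ τ| ≤ D * (β - τ) ^ (P + 1) ∧
        |charKernelSlope lam q β τ τ| ≤ D * (β - τ) ^ (P + 1) := by
  obtain ⟨j, c, hc, hj⟩ := exists_order_of_derivJumpAt hq0 hjump
  have hlim := tendsto_integral_div_pow hq hj
  have hB : ∀ τ, |1 / 2 * ∫ s in τ..β, q s| ≤ 1 / 2 * ∫ s, |q s| := by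
    intro τ
    rw [abs_mul, abs_of_pos (by norm_num : (0 : ℝ) < 1 / 2)]
    refine mul_le_mul_of_nonneg_left ?_ (by norm_num)
    refine (norm_integral_le_integral_norm_uIoc (f := q)).trans ?_
    exact setIntegral_le_integral hq.norm (Eventually.of_forall fun _ => norm_nonneg _)
  obtain ⟨A, hA⟩ := exists_bound_of_tendsto_div_pow hB (by simp) hlim
  obtain ⟨D, hD⟩ := exists_charKernel_bound (lam := lam) hq hA
  have hD0 : 0 ≤ D := by
    have := (abs_nonneg _).trans (hD 0 ⟨le_rfl, hβ.le⟩ 0 ⟨le_rfl, hβ.le⟩).1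
    exact nonneg_of_mul_nonneg_left this (pow_pos (by linarith) _)
  refine ⟨j, c / (2 * (j + 1)), div_ne_zero hc (by positivity), D + (|A| + D * β), ?_, ?_⟩
  · have h0 : Tendsto (fun τ => D * (β - τ)) (𝓝[<] β) (𝓝 0) := by
      have : Tendsto (fun τ => D * (β - τ)) (𝓝 β) (𝓝 (D * (β - β))) :=
        (by fun_prop : Continuous fun τ => D * (β - τ)).tendsto β
      rw [sub_self, mul_zero] at this
      exact this.mono_left nhdsWithin_le_nhds
    have h1 : Tendsto (fun τ => (charKernel lam q β τ τ - 1 / 2 * ∫ s in τ..β, q s) /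
        (β - τ) ^ (j + 1)) (𝓝[<] β) (𝓝 0) := by
      refine squeeze_zero_norm' ?_ h0
      filter_upwards [Ioo_mem_nhdsLT hβ] with τ hτ
      have hτ' : τ ∈ Icc 0 β := ⟨hτ.1.le, hτ.2.le⟩
      have hp : 0 < (β - τ) ^ (j + 1) := pow_pos (sub_pos.2 hτ.2) _
      rw [norm_div, Real.norm_eq_abs, Real.norm_eq_abs, abs_of_pos hp, div_le_iff₀ hp]
      refine (hD τ hτ' τ hτ').2.trans (le_of_eq ?_)
      ring
    refine (hlim.add h1).congr (fun τ => ?_) |>.trans (by rw [add_zero])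
    rw [← add_div, add_sub_cancel]
  · intro τ hτ
    have hp : 0 ≤ (β - τ) ^ (j + 1) := pow_nonneg (sub_nonneg.2 hτ.2) _
    obtain ⟨h1, h2⟩ := hD τ hτ τ hτ
    constructor
    · have h3 := hA τ hτ
      have h4 : D * (β - τ) ^ (j + 1 + 1) ≤ D * β * (β - τ) ^ (j + 1) := by
        rw [pow_succ, mul_comm ((β - τ) ^ (j + 1)), ← mul_assoc]
        gcongr
        linarith [hτ.1]
      have h5 : A * (β - τ) ^ (j + 1) ≤ |A| * (β - τ) ^ (j + 1) :=
        mul_le_mul_of_nonneg_right (le_abs_self A) hp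
      have h6 := abs_sub_abs_le_abs_sub (charKernel lam q β τ τ) (1 / 2 * ∫ s in τ..β, q s)
      have h7 := mul_nonneg hD0 hp
      nlinarith
    · refine h1.trans (mul_le_mul_of_nonneg_right ?_ hp)
      have := mul_nonneg hD0 hβ.le
      linarith [abs_nonneg A]

/-! ### Coefficients of the hypergeometric series -/

/-- The coefficients of the hypergeometric series in the unperturbed Jost solution. -/
def jostCoeff (lam : ℝ) (z : ℂ) (n : ℕ) : ℂ :=
  ordinaryHypergeometricCoefficient (parC z - parA lam z) (parC z - parB lam z) (parC z) n

lemma root_sq (lam : ℝ) : root lam ^ 2 = 1 / 4 - lam := by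
  unfold root
  split_ifs with h
  · rw [← Complex.ofReal_pow, Real.sq_sqrt h]
    push_cast
    ring
  · rw [mul_pow, ← Complex.ofReal_pow, Real.sq_sqrt (by linarith), Complex.I_sq]
    push_cast
    ring

lemma eval_ascPochhammer_eq_prod (c : ℂ) (n : ℕ) :
    (ascPochhammer ℂ n).eval c = ∏ k ∈ Finset.range n, (c + k) := by
  induction n with
  | zero => simp
  | succ n ih => rw [ascPochhammer_succ_eval, Finset.prod_range_succ, ih]

/-- The two numerator parameters add up to `1` and have product `lam`, so the numerators are real
products. -/
lemma jostCoeff_eq (lam : ℝ) (z : ℂ) (n : ℕ) :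
    jostCoeff lam z n = ((∏ k ∈ Finset.range n, ((k : ℝ) ^ 2 + k + lam) : ℝ) : ℂ) /
      (n.factorial * ∏ k ∈ Finset.range n, (parC z + k)) := by
  have h : (∏ k ∈ Finset.range n, (parC z - parA lam z + k)) *
      (∏ k ∈ Finset.range n, (parC z - parB lam z + k)) =
      ((∏ k ∈ Finset.range n, ((k : ℝ) ^ 2 + k + lam) : ℝ) : ℂ) := by
    rw [← Finset.prod_mul_distrib]
    push_cast
    refine Finset.prod_congr rfl fun k _ => ?_
    simp only [parA, parB, parC]
    linear_combination -(root_sq lam)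
  rw [jostCoeff, ordinaryHypergeometricCoefficient, eval_ascPochhammer_eq_prod,
    eval_ascPochhammer_eq_prod, eval_ascPochhammer_eq_prod, mul_assoc (_⁻¹), h, div_eq_mul_inv,
    mul_inv]
  ring

lemma exists_abs_prod_le (lam : ℝ) : ∃ C, 0 < C ∧ ∀ n : ℕ,
    |∏ k ∈ Finset.range n, ((k : ℝ) ^ 2 + k + lam)| ≤ C * (n.factorial : ℝ) ^ 2 := by
  obtain ⟨N, hN⟩ := exists_nat_ge |lam|
  set e : ℕ → ℝ := fun n => |∏ k ∈ Finset.range n, ((k : ℝ) ^ 2 + k + lam)| with he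
  have he0 : ∀ n, 0 ≤ e n := fun n => abs_nonneg _
  set C := 1 + ∑ k ∈ Finset.range (N + 1), e k with hC
  have hC1 : 0 < C := add_pos_of_pos_of_nonneg one_pos (Finset.sum_nonneg fun _ _ => he0 _)
  refine ⟨C, hC1, fun n => ?_⟩
  have hsmall : ∀ n ≤ N, e n ≤ C * (n.factorial : ℝ) ^ 2 := by
    intro n hn
    have h1 : e n ≤ ∑ k ∈ Finset.range (N + 1), e k :=
      Finset.single_le_sum (f := e) (fun _ _ => he0 _) (Finset.mem_range.2 (by omega))
    have h2 : (1 : ℝ) ≤ (n.factorial : ℝ) ^ 2 :=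
      one_le_pow₀ (by exact_mod_cast Nat.one_le_iff_ne_zero.2 n.factorial_ne_zero)
    nlinarith
  rcases le_total n N with hn | hn
  · exact hsmall n hn
  · induction n, hn using Nat.le_induction with
    | base => exact hsmall N le_rfl
    | succ n hn ih =>
      have h1 : |(n : ℝ) ^ 2 + n + lam| ≤ ((n : ℝ) + 1) ^ 2 := by
        have hnN : (N : ℝ) ≤ n := by exact_mod_cast hn
        have h2 := abs_le.1 (hN.trans hnN)
        have h3 : (0 : ℝ) ≤ n := Nat.cast_nonneg n
        exact abs_le.2 ⟨by nlinarith [h2.1], by nlinarith [h2.2]⟩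
      rw [Finset.prod_range_succ, abs_mul, Nat.factorial_succ]
      push_cast
      calc _ ≤ C * (n.factorial : ℝ) ^ 2 * ((n : ℝ) + 1) ^ 2 := by gcongr
        _ = _ := by ring

/-- Lower bound for a shifted factorial `∏ d k`, `d k = |c + k|`, when `c` lies to the left of the
origin but keeps a distance `ε` from the nonpositive integers. Apart from the two smallest factors,
estimated by `ε`, the product is at least `M! (n - M - 2)!` once `n ≥ M + 2`. So `n!` divided by it
is, up to a polynomial in `n`, at most a binomial coefficient, which the parameter `κ` in
`(1 + κ) ^ n / κ ^ M` allows to bound in various ways. -/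
lemma factorial_le_prod {d : ℕ → ℝ} {ε κ : ℝ} {M : ℕ} (hε0 : 0 < ε) (hε1 : ε ≤ 1) (hκ0 : 0 ≤ κ)
    (hκ1 : κ ≤ 1) (hd : ∀ k, ε ≤ d k) (hleft : ∀ k : ℕ, (M : ℝ) - k ≤ d k)
    (hright : ∀ k : ℕ, (k : ℝ) - (M + 1) ≤ d k) (n : ℕ) :
    ε ^ 2 * κ ^ M * n.factorial ≤
      ((n : ℝ) + 1) ^ 2 * (1 + κ) ^ n * ∏ k ∈ Finset.range n, d k := by
  have hdpos : ∀ k, 0 < d k := fun k => hε0.trans_le (hd k)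
  have hprod : ∀ n, 0 < ∏ k ∈ Finset.range n, d k := fun n => Finset.prod_pos fun k _ => hdpos k
  have h1 : ∀ n ≤ M, (M.factorial : ℝ) ≤
      (∏ k ∈ Finset.range n, d k) * (M - n).factorial := by
    intro n
    induction n with
    | zero => simp
    | succ n ih =>
      intro hn
      refine (ih (by omega)).trans ?_
      rw [Finset.prod_range_succ, mul_assoc]
      refine mul_le_mul_of_nonneg_left ?_ (hprod n).le
      have e : M - n = (M - (n + 1)) + 1 := by omega
      rw [e, Nat.factorial_succ, ← e]
      push_cast
      refine mul_le_mul_of_nonneg_right ?_ (by positivity)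
      rw [Nat.cast_sub (by omega)]
      exact hleft n
  have hM : ε * M.factorial ≤ ∏ k ∈ Finset.range (M + 1), d k := by
    rw [Finset.prod_range_succ, mul_comm]
    have := h1 M le_rfl
    simp only [Nat.sub_self, Nat.factorial_zero, Nat.cast_one, mul_one] at this
    exact mul_le_mul this (hd M) hε0.le (hprod M).le
  have h2 : ∀ j : ℕ, ε ^ 2 * (M.factorial * j.factorial) ≤
      ∏ k ∈ Finset.range (M + 2 + j), d k := by
    intro j
    induction j with
    | zero =>
      rw [add_zero, Finset.prod_range_succ]
      calc _ = (ε * M.factorial) * ε := by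
            simp
            ring
        _ ≤ _ := mul_le_mul hM (hd _) hε0.le (hprod _).le
    | succ j ih =>
      rw [← add_assoc, Finset.prod_range_succ, Nat.factorial_succ]
      have h3 := hright (M + 2 + j)
      push_cast at h3 ⊢
      calc _ = (ε ^ 2 * (M.factorial * j.factorial)) * ((j : ℝ) + 1) := by ring
        _ ≤ _ := mul_le_mul ih (by linarith) (by positivity) (hprod _).le
  have hκM : κ ^ M ≤ 1 := pow_le_one₀ hκ0 hκ1
  have hε2 : ε ^ 2 ≤ 1 := pow_le_one₀ hε0.le hε1
  have hκn : 1 ≤ (1 + κ) ^ n := one_le_pow₀ (by linarith)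
  rcases le_or_gt n M with hn | hn
  · have h3 : (n.factorial : ℝ) ≤ ∏ k ∈ Finset.range n, d k := by
      have h4 : ((n.factorial * (M - n).factorial : ℕ) : ℝ) ≤ M.factorial := by
        exact_mod_cast Nat.le_of_dvd M.factorial_pos (Nat.factorial_mul_factorial_dvd_factorial hn)
      push_cast at h4
      exact le_of_mul_le_mul_right (h4.trans (h1 n hn)) (by positivity)
    calc ε ^ 2 * κ ^ M * n.factorial ≤ 1 * 1 * n.factorial := by gcongr
      _ ≤ ((n : ℝ) + 1) ^ 2 * (1 + κ) ^ n * ∏ k ∈ Finset.range n, d k := by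
        gcongr
        exact one_le_pow₀ (by linarith [Nat.cast_nonneg (α := ℝ) n])
  rcases eq_or_lt_of_le (Nat.succ_le_of_lt hn) with hn' | hn'
  · subst hn'
    rw [Nat.succ_eq_add_one, Nat.factorial_succ] at *
    have h5 : ε ^ 2 * κ ^ M ≤ ε := by
      calc ε ^ 2 * κ ^ M ≤ ε ^ 2 * 1 := by gcongr
        _ = ε * ε := by ring
        _ ≤ ε * 1 := by gcongr
        _ = ε := mul_one _
    push_cast
    have hMn : (0 : ℝ) ≤ M := Nat.cast_nonneg M
    calc ε ^ 2 * κ ^ M * (((M : ℝ) + 1) * M.factorial)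
        ≤ ε * (((M : ℝ) + 1) * M.factorial) := by gcongr
      _ = ((M : ℝ) + 1) * 1 * (ε * M.factorial) := by ring
      _ ≤ ((M : ℝ) + 1 + 1) ^ 2 * (1 + κ) ^ (M + 1) * ∏ k ∈ Finset.range (M + 1), d k := by
        gcongr
        nlinarith
  · obtain ⟨j, rfl⟩ := Nat.exists_eq_add_of_le hn'
    rw [show M.succ.succ + j = M + 2 + j by omega] at *
    have h6 : ((M + 2 + j).factorial : ℝ) = ((M : ℝ) + j + 2) * (M + j + 1) *
        ((M + j).choose M * (M.factorial * j.factorial)) := by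
      have h7 := Nat.choose_mul_factorial_mul_factorial (Nat.le_add_right M j)
      rw [Nat.add_sub_cancel_left] at h7
      rw [show M + 2 + j = (M + j + 1) + 1 by omega, Nat.factorial_succ, Nat.factorial_succ, ← h7]
      push_cast
      ring
    have h8 : κ ^ M * (M + j).choose M ≤ (1 + κ) ^ (M + j) := by
      rw [add_comm 1 κ, add_pow]
      refine le_trans (le_of_eq ?_) (Finset.single_le_sum
        (f := fun m => κ ^ m * 1 ^ (M + j - m) * ((M + j).choose m : ℝ))
        (fun m _ => by positivity) (Finset.mem_range.2 (by omega : M < M + j + 1)))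
      simp
    have hMj : (0 : ℝ) ≤ M := Nat.cast_nonneg M
    have hj : (0 : ℝ) ≤ j := Nat.cast_nonneg j
    calc ε ^ 2 * κ ^ M * (M + 2 + j).factorial
        = (((M : ℝ) + j + 2) * (M + j + 1)) * (κ ^ M * (M + j).choose M) *
            (ε ^ 2 * (M.factorial * j.factorial)) := by
          rw [h6]
          ring
      _ ≤ (((M + 2 + j : ℕ) : ℝ) + 1) ^ 2 * (1 + κ) ^ (M + 2 + j) *
            ∏ k ∈ Finset.range (M + 2 + j), d k := by
          have h9 : (1 + κ) ^ (M + j) ≤ (1 + κ) ^ (M + 2 + j) :=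
            pow_le_pow_right₀ (by linarith) (by omega)
          refine mul_le_mul (mul_le_mul ?_ (h8.trans h9) (by positivity) (by positivity)) (h2 j)
            (by positivity) (by positivity)
          push_cast
          nlinarith

/-- The part of the half-plane `Im z ≤ -1` outside the discs of radius `η` around the poles. -/
def goodSet (η : ℝ) : Set ℂ := {z | z.im ≤ -1 ∧ z ∉ discs η}

lemma le_norm_parC_add {η : ℝ} {z : ℂ} (hz : z ∉ discs η) (k : ℕ) : η ≤ ‖parC z + k‖ := by
  simp only [discs, mem_iUnion, Metric.mem_ball, not_exists, not_lt] at hz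
  refine (hz k).trans (le_of_eq ?_)
  rw [dist_eq_norm, ← one_mul ‖parC z + k‖, ← Complex.norm_I, ← norm_mul]
  congr 1
  simp only [parC]
  linear_combination z * Complex.I_sq

lemma re_parC_add (z : ℂ) (k : ℕ) : (parC z + k).re = 1 + z.im + k := by
  simp [parC]

/-- Estimate of the hypergeometric coefficients away from the poles. The free parameter `ρ`
trades growth in `n` for growth in `-Im z`. -/
lemma exists_norm_jostCoeff_le (lam : ℝ) {η : ℝ} (hη : 0 < η) : ∃ C, 0 < C ∧
    ∀ ρ, 0 ≤ ρ → ∀ z ∈ goodSet η, ∀ n : ℕ, ‖jostCoeff lam z n‖ ≤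
      C * Real.exp (ρ * -z.im) * (((n : ℝ) + 1) ^ 2 * (1 + Real.exp (-ρ)) ^ n) := by
  obtain ⟨C, hC0, hC⟩ := exists_abs_prod_le lam
  set ε := min η 1 with hε
  have hε0 : 0 < ε := lt_min hη one_pos
  refine ⟨C / ε ^ 2, by positivity, fun ρ hρ z hz n => ?_⟩
  have hpos : ∀ k : ℕ, ε ≤ ‖parC z + k‖ := fun k =>
    (min_le_left _ _).trans (le_norm_parC_add hz.2 k)
  have hy1 : 1 ≤ -z.im := by linarith [hz.1]
  obtain ⟨M, hM⟩ : ∃ M : ℕ, ⌊-z.im⌋₊ = M + 1 :=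
    ⟨⌊-z.im⌋₊ - 1, by have := (Nat.one_le_floor_iff _).2 hy1; omega⟩
  have hfl : ((M : ℝ) + 1) ≤ -z.im := by
    have := Nat.floor_le (show 0 ≤ -z.im by linarith)
    rw [hM] at this
    exact_mod_cast this
  have hfu : -z.im < (M : ℝ) + 1 + 1 := by
    have := Nat.lt_floor_add_one (-z.im)
    rw [hM] at this
    exact_mod_cast this
  have hre : ∀ k : ℕ, |1 + z.im + k| ≤ ‖parC z + k‖ := fun k => by
    rw [← re_parC_add]
    exact Complex.abs_re_le_norm _
  have key := factorial_le_prod (d := fun k => ‖parC z + k‖) (κ := Real.exp (-ρ)) (M := M) hε0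
    (min_le_right _ _) (Real.exp_pos _).le (Real.exp_le_one_iff.2 (by linarith)) hpos
    (fun k => by
      have := (abs_le.1 (hre k)).1
      have := neg_abs_le (1 + z.im + k)
      linarith [hre k])
    (fun k => by
      have := le_abs_self (1 + z.im + k)
      linarith [hre k]) n
  have hP : 0 < ∏ k ∈ Finset.range n, ‖parC z + k‖ :=
    Finset.prod_pos fun k _ => hε0.trans_le (hpos k)
  have hexp : Real.exp (-(ρ * -z.im)) ≤ Real.exp (-ρ) ^ M := by
    rw [← Real.exp_nat_mul]
    refine Real.exp_le_exp.2 ?_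
    nlinarith
  have hfac : (0 : ℝ) < n.factorial := by positivity
  rw [jostCoeff_eq, norm_div, norm_mul, norm_prod, Complex.norm_real, Complex.norm_natCast,
    Real.norm_eq_abs, div_le_iff₀ (by positivity)]
  refine (hC n).trans ?_
  have h1 : ε ^ 2 * n.factorial ≤ Real.exp (ρ * -z.im) *
      (((n : ℝ) + 1) ^ 2 * (1 + Real.exp (-ρ)) ^ n * ∏ k ∈ Finset.range n, ‖parC z + k‖) := by
    have h2 : ε ^ 2 * Real.exp (-(ρ * -z.im)) * n.factorial ≤
        ((n : ℝ) + 1) ^ 2 * (1 + Real.exp (-ρ)) ^ n * ∏ k ∈ Finset.range n, ‖parC z + k‖ :=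
      le_trans (by gcongr) key
    calc ε ^ 2 * (n.factorial : ℝ) = Real.exp (ρ * -z.im) *
          (ε ^ 2 * Real.exp (-(ρ * -z.im)) * n.factorial) := by
          rw [Real.exp_neg]
          field_simp
      _ ≤ _ := by gcongr
  calc C * (n.factorial : ℝ) ^ 2 = C / ε ^ 2 * n.factorial * (ε ^ 2 * n.factorial) := by
        field_simp
    _ ≤ C / ε ^ 2 * n.factorial * (Real.exp (ρ * -z.im) *
      (((n : ℝ) + 1) ^ 2 * (1 + Real.exp (-ρ)) ^ n * ∏ k ∈ Finset.range n, ‖parC z + k‖)) := by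
        gcongr
    _ = _ := by ring

/-! ### The hypergeometric factor of the unperturbed Jost solution -/

lemma summable_succ_cube_mul_pow {x : ℝ} (hx0 : 0 ≤ x) (hx1 : x < 1) :
    Summable fun n : ℕ => ((n : ℝ) + 1) ^ 3 * x ^ n := by
  have h1 := summable_pow_mul_geometric_of_norm_lt_one (R := ℝ) 3
    (r := x) (by rwa [Real.norm_of_nonneg hx0])
  have h2 := summable_geometric_of_lt_one hx0 hx1
  refine Summable.of_nonneg_of_le (fun n => by positivity) (fun n => ?_)
    ((h1.add h2).mul_left 8)
  have h3 : ((n : ℝ) + 1) ^ 3 ≤ 8 * ((n : ℝ) ^ 3 + 1) := by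
    have : (0 : ℝ) ≤ n := Nat.cast_nonneg n
    nlinarith [mul_nonneg this (sq_nonneg ((n : ℝ) - 1)), sq_nonneg ((n : ℝ) - 1)]
  calc _ ≤ 8 * ((n : ℝ) ^ 3 + 1) * x ^ n := by gcongr
    _ = _ := by ring

section PowerSeries

variable {a : ℕ → ℂ} {D R r : ℝ}

lemma norm_succ_mul_coeff_le (hD : 0 ≤ D) (hR : 0 ≤ R) (hr : 0 ≤ r)
    (ha : ∀ n : ℕ, ‖a n‖ ≤ D * (((n : ℝ) + 1) ^ 2 * R ^ n)) (n : ℕ) :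
    ((n : ℝ) + 1) * ‖a (n + 1)‖ * r ^ n ≤ 4 * D * R * (((n : ℝ) + 1) ^ 3 * (R * r) ^ n) := by
  have h1 := ha (n + 1)
  push_cast at h1
  have hn : (0 : ℝ) ≤ n := Nat.cast_nonneg n
  calc ((n : ℝ) + 1) * ‖a (n + 1)‖ * r ^ n
      ≤ ((n : ℝ) + 1) * (D * (((n : ℝ) + 1 + 1) ^ 2 * R ^ (n + 1))) * r ^ n := by gcongr
    _ ≤ ((n : ℝ) + 1) * (D * ((2 * ((n : ℝ) + 1)) ^ 2 * R ^ (n + 1))) * r ^ n := by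
        gcongr
        linarith
    _ = _ := by
        rw [mul_pow R, pow_succ R]
        ring

lemma norm_coeff_mul_pow_le (hD : 0 ≤ D) (hR : 0 ≤ R) (hr : 0 ≤ r)
    (ha : ∀ n : ℕ, ‖a n‖ ≤ D * (((n : ℝ) + 1) ^ 2 * R ^ n)) (n : ℕ) :
    ‖a n‖ * r ^ n ≤ D * (((n : ℝ) + 1) ^ 3 * (R * r) ^ n) := by
  have hn : (0 : ℝ) ≤ n := Nat.cast_nonneg n
  calc ‖a n‖ * r ^ n ≤ D * (((n : ℝ) + 1) ^ 2 * R ^ n) * r ^ n := by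
        gcongr
        exact ha n
    _ ≤ D * (((n : ℝ) + 1) ^ 3 * R ^ n) * r ^ n := by
        gcongr
        · linarith
        · norm_num
    _ = _ := by
        rw [mul_pow R]
        ring

lemma norm_mul_ofReal_pow_le {x : ℝ} (b : ℂ) (hx : |x| ≤ r) (n : ℕ) :
    ‖b * (x : ℂ) ^ n‖ ≤ ‖b‖ * r ^ n := by
  rw [norm_mul, norm_pow, Complex.norm_real, Real.norm_eq_abs]
  gcongr

lemma norm_succ_mul (b : ℂ) (n : ℕ) : ‖((n : ℂ) + 1) * b‖ = ((n : ℝ) + 1) * ‖b‖ := by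
  rw [norm_mul]
  congr 1
  exact_mod_cast Complex.norm_natCast (n + 1)

lemma hasDerivAt_tsum_mul_pow (hD : 0 ≤ D) (hR : 0 ≤ R) (hRr : R * r < 1)
    (ha : ∀ n : ℕ, ‖a n‖ ≤ D * (((n : ℝ) + 1) ^ 2 * R ^ n)) {x : ℝ} (hx : |x| < r) :
    HasDerivAt (fun y : ℝ => ∑' n, a n * (y : ℂ) ^ n)
      (∑' n : ℕ, ((n : ℂ) + 1) * a (n + 1) * (x : ℂ) ^ n) x := by
  have hr : 0 ≤ r := (abs_nonneg x).trans hx.le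
  have hs := summable_succ_cube_mul_pow (mul_nonneg hR hr) hRr
  have hsum : ∀ y ∈ Ioo (-r) r, Summable fun n => a n * (y : ℂ) ^ n := fun y hy =>
    (hs.mul_left D).of_norm_bounded fun n =>
      (norm_mul_ofReal_pow_le _ (abs_lt.2 hy).le n).trans (norm_coeff_mul_pow_le hD hR hr ha n)
  have key := hasDerivAt_tsum_of_isPreconnected (t := Ioo (-r) r)
    (u := fun n : ℕ => 4 * D * R * (((n : ℝ) + 1) ^ 3 * (R * r) ^ n))
    (g := fun n (y : ℝ) => a (n + 1) * (y : ℂ) ^ (n + 1))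
    (g' := fun n (y : ℝ) => ((n : ℂ) + 1) * a (n + 1) * (y : ℂ) ^ n)
    (hs.mul_left _) isOpen_Ioo isPreconnected_Ioo ?_ ?_ (abs_lt.1 hx)
    ((summable_nat_add_iff 1).2 (hsum x (abs_lt.1 hx))) (abs_lt.1 hx)
  · refine (key.const_add (a 0)).congr_of_eventuallyEq ?_
    filter_upwards [Ioo_mem_nhds (abs_lt.1 hx).1 (abs_lt.1 hx).2] with y hy
    rw [(hsum y hy).tsum_eq_zero_add]
    simp
  · intro n y _
    have h1 := ((hasDerivAt_pow (n + 1) (y : ℂ)).comp_ofReal).const_mul (a (n + 1))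
    refine h1.congr_deriv ?_
    push_cast
    ring
  · intro n y hy
    refine (norm_mul_ofReal_pow_le _ (abs_lt.2 hy).le n).trans ?_
    rw [norm_succ_mul]
    exact norm_succ_mul_coeff_le hD hR hr ha n

lemma continuousOn_tsum_succ_mul_pow (hD : 0 ≤ D) (hR : 0 ≤ R) (hr : 0 ≤ r) (hRr : R * r < 1)
    (ha : ∀ n : ℕ, ‖a n‖ ≤ D * (((n : ℝ) + 1) ^ 2 * R ^ n)) :
    ContinuousOn (fun x : ℝ => ∑' n : ℕ, ((n : ℂ) + 1) * a (n + 1) * (x : ℂ) ^ n)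
      (Ioo (-r) r) := by
  have hs := summable_succ_cube_mul_pow (mul_nonneg hR hr) hRr
  refine continuousOn_tsum (fun n => by fun_prop) (hs.mul_left (4 * D * R)) fun n y hy => ?_
  refine (norm_mul_ofReal_pow_le _ (abs_lt.2 hy).le n).trans ?_
  rw [norm_succ_mul]
  exact norm_succ_mul_coeff_le hD hR hr ha n

end PowerSeries

/-- The hypergeometric factor of the unperturbed Jost solution, as a function of a real
argument. -/
def hyp (lam : ℝ) (z : ℂ) (x : ℝ) : ℂ := ∑' n, jostCoeff lam z n * (x : ℂ) ^ n

/-- The derivative of the hypergeometric factor `hyp`. -/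
def hypDeriv (lam : ℝ) (z : ℂ) (x : ℝ) : ℂ :=
  ∑' n : ℕ, ((n : ℂ) + 1) * jostCoeff lam z (n + 1) * (x : ℂ) ^ n

lemma jostFreePlus_eq (lam x : ℝ) (z : ℂ) : jostFreePlus lam x z =
    Complex.exp (Complex.I * z * x) * hyp lam z (1 / (1 + Real.exp (2 * x))) := by
  rw [jostFreePlus, ordinaryHypergeometric_eq_tsum]
  rfl

lemma exists_hyp_ratio {r : ℝ} (hr0 : 0 ≤ r) (hr : r < 1) :
    ∃ ρ, 0 ≤ ρ ∧ (1 + Real.exp (-ρ)) * r < 1 := by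
  refine ⟨-Real.log ((1 - r) / 2), ?_, ?_⟩
  · have := Real.log_nonpos (show 0 ≤ (1 - r) / 2 by linarith) (by linarith)
    linarith
  · rw [neg_neg, Real.exp_log (by linarith)]
    nlinarith

lemma hasDerivAt_hyp (hη : 0 < η) {z : ℂ} (hz : z ∈ goodSet η) {x : ℝ} (hx : |x| < 1) :
    HasDerivAt (hyp lam z) (hypDeriv lam z x) x := by
  obtain ⟨C, hC0, hC⟩ := exists_norm_jostCoeff_le lam hη
  obtain ⟨r, hxr, hr1⟩ := exists_between hx
  obtain ⟨ρ, hρ, hρr⟩ := exists_hyp_ratio ((abs_nonneg x).trans hxr.le) hr1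
  exact hasDerivAt_tsum_mul_pow (by positivity) (by positivity) hρr (hC ρ hρ z hz) hxr

lemma continuousAt_hypDeriv (hη : 0 < η) {z : ℂ} (hz : z ∈ goodSet η) {x : ℝ} (hx : |x| < 1) :
    ContinuousAt (hypDeriv lam z) x := by
  obtain ⟨C, hC0, hC⟩ := exists_norm_jostCoeff_le lam hη
  obtain ⟨r, hxr, hr1⟩ := exists_between hx
  obtain ⟨ρ, hρ, hρr⟩ := exists_hyp_ratio ((abs_nonneg x).trans hxr.le) hr1
  exact (continuousOn_tsum_succ_mul_pow (by positivity) (by positivity)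
    ((abs_nonneg x).trans hxr.le) hρr (hC ρ hρ z hz)).continuousAt
      (Ioo_mem_nhds (abs_lt.1 hxr).1 (abs_lt.1 hxr).2)

lemma jostCoeff_zero (lam : ℝ) (z : ℂ) : jostCoeff lam z 0 = 1 := by
  simp [jostCoeff_eq]

/-- Away from the poles the hypergeometric factor grows at most like `exp (-ρ Im z)`, uniformly
for `x ≤ r`, whenever `(1 + exp (-ρ)) r < 1`. -/
lemma exists_norm_hyp_le (lam : ℝ) (hη : 0 < η) {ρ r : ℝ} (hρ : 0 ≤ ρ) (hr : 0 ≤ r)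
    (hρr : (1 + Real.exp (-ρ)) * r < 1) :
    ∃ M, ∀ z ∈ goodSet η, ∀ x ∈ Icc 0 r, ‖hyp lam z x‖ ≤ M * Real.exp (ρ * -z.im) ∧
      ‖hypDeriv lam z x‖ ≤ M * Real.exp (ρ * -z.im) := by
  obtain ⟨C, hC0, hC⟩ := exists_norm_jostCoeff_le lam hη
  have hR : 0 ≤ 1 + Real.exp (-ρ) := by positivity
  have hs := summable_succ_cube_mul_pow (mul_nonneg hR hr) hρr
  set T := ∑' n : ℕ, ((n : ℝ) + 1) ^ 3 * ((1 + Real.exp (-ρ)) * r) ^ n with hT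
  have hT0 : 0 ≤ T := tsum_nonneg fun n => by positivity
  refine ⟨C * T + 4 * C * (1 + Real.exp (-ρ)) * T, fun z hz x hx => ?_⟩
  have hD : 0 ≤ C * Real.exp (ρ * -z.im) := by positivity
  have hxr : |x| ≤ r := by
    rw [abs_of_nonneg hx.1]
    exact hx.2
  have h1 : ‖hyp lam z x‖ ≤ C * Real.exp (ρ * -z.im) * T :=
    tsum_of_norm_bounded (hs.hasSum.mul_left _) fun n =>
      (norm_mul_ofReal_pow_le _ hxr n).trans (norm_coeff_mul_pow_le hD hR hr (hC ρ hρ z hz) n)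
  have h2 : ‖hypDeriv lam z x‖ ≤
      4 * (C * Real.exp (ρ * -z.im)) * (1 + Real.exp (-ρ)) * T := by
    refine tsum_of_norm_bounded (hs.hasSum.mul_left _) fun n => ?_
    refine (norm_mul_ofReal_pow_le _ hxr n).trans ?_
    rw [norm_succ_mul]
    exact norm_succ_mul_coeff_le hD hR hr (hC ρ hρ z hz) n
  have h3 : 0 ≤ C * T * Real.exp (ρ * -z.im) := by positivity
  have h4 : 0 ≤ 4 * C * (1 + Real.exp (-ρ)) * T * Real.exp (ρ * -z.im) := by positivity
  constructor
  · refine h1.trans ?_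
    linarith
  · refine h2.trans ?_
    linarith

/-- Each coefficient of positive index tends to zero as `z → ∞` away from the poles. -/
lemma tendsto_jostCoeff_succ (lam : ℝ) (hη : 0 < η) (n : ℕ) :
    Tendsto (fun z => jostCoeff lam z (n + 1)) (comap norm atTop ⊓ 𝓟 (goodSet η)) (𝓝 0) := by
  obtain ⟨C, hC⟩ : ∃ C, C = |∏ k ∈ Finset.range (n + 1), ((k : ℝ) ^ 2 + k + lam)| / η ^ n :=
    ⟨_, rfl⟩
  have hC0 : 0 ≤ C := by
    rw [hC]
    positivity
  have hlim : Tendsto (fun z : ℂ => C / (‖z‖ - 1)) (comap norm atTop ⊓ 𝓟 (goodSet η)) (𝓝 0) := by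
    refine Tendsto.const_div_atTop ?_ C
    have : Tendsto (fun z : ℂ => ‖z‖) (comap norm atTop ⊓ 𝓟 (goodSet η)) atTop :=
      tendsto_comap.mono_left inf_le_left
    exact tendsto_atTop_add_const_right _ (-1) this
  refine squeeze_zero_norm' ?_ hlim
  have h1 : ∀ᶠ z : ℂ in comap norm atTop ⊓ 𝓟 (goodSet η), 1 < ‖z‖ :=
    (tendsto_comap.eventually (eventually_gt_atTop 1)).filter_mono inf_le_left
  filter_upwards [h1, mem_inf_of_right (mem_principal_self _)] with z hz1 hz
  have h2 : ‖z‖ - 1 ≤ ‖parC z‖ := by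
    have h3 := norm_sub_norm_le (Complex.I * z) 1
    rw [norm_mul, Complex.norm_I, one_mul, norm_one, norm_sub_rev] at h3
    exact h3
  have h4 : (‖z‖ - 1) * η ^ n ≤ ∏ k ∈ Finset.range (n + 1), ‖parC z + k‖ := by
    rw [Finset.prod_range_succ', mul_comm]
    refine mul_le_mul ?_ (by simpa using h2) (by linarith)
      (Finset.prod_nonneg fun _ _ => norm_nonneg _)
    calc η ^ n = ∏ _k ∈ Finset.range n, η := by simp
      _ ≤ _ := Finset.prod_le_prod (fun _ _ => hη.le) fun k _ => le_norm_parC_add hz.2 (k + 1)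
  have h5 : (1 : ℝ) ≤ (n + 1).factorial := by
    exact_mod_cast Nat.one_le_iff_ne_zero.2 (Nat.factorial_ne_zero _)
  have h6 : 0 < (‖z‖ - 1) * η ^ n := mul_pos (by linarith) (by positivity)
  rw [jostCoeff_eq, norm_div, norm_mul, norm_prod, Complex.norm_real, Complex.norm_natCast,
    Real.norm_eq_abs, hC, div_div]
  refine div_le_div_of_nonneg_left (abs_nonneg _) (by rw [mul_comm]; exact h6) ?_
  nlinarith

/-- For `x ≤ r < 1 / 2` the hypergeometric factor tends to `1`, uniformly in `x`, by Tannery's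
theorem. -/
lemma eventually_norm_hyp_sub_one_le (lam : ℝ) (hη : 0 < η) {r : ℝ} (hr0 : 0 ≤ r) (hr : r < 1 / 2)
    {ε : ℝ} (hε : 0 < ε) :
    ∀ᶠ z in comap norm atTop ⊓ 𝓟 (goodSet η), ∀ x ∈ Icc 0 r,
      ‖hyp lam z x - 1‖ ≤ ε ∧ ‖hypDeriv lam z x‖ ≤ ε := by
  obtain ⟨C, hC0, hC⟩ := exists_norm_jostCoeff_le lam hη
  have hbd : ∀ z ∈ goodSet η, ∀ n : ℕ, ‖jostCoeff lam z n‖ ≤ C * (((n : ℝ) + 1) ^ 2 * 2 ^ n) := by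
    intro z hz n
    have := hC 0 le_rfl z hz n
    norm_num at this
    exact this
  have hs := summable_succ_cube_mul_pow (by positivity : 0 ≤ 2 * r) (by linarith)
  have htan : Tendsto (fun z => ∑' n : ℕ, ((n : ℝ) + 1) * ‖jostCoeff lam z (n + 1)‖ * r ^ n)
      (comap norm atTop ⊓ 𝓟 (goodSet η)) (𝓝 (∑' _ : ℕ, (0 : ℝ))) := by
    refine tendsto_tsum_of_dominated_convergence (hs.mul_left (4 * C * 2)) (fun n => ?_) ?_
    · have := (((tendsto_jostCoeff_succ lam hη n).norm).const_mul ((n : ℝ) + 1)).mul_const (r ^ n)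
      simpa using this
    · filter_upwards [mem_inf_of_right (mem_principal_self _)] with z hz n
      rw [Real.norm_of_nonneg (by positivity)]
      exact norm_succ_mul_coeff_le hC0.le (by norm_num) hr0 (hbd z hz) n
  rw [tsum_zero] at htan
  filter_upwards [htan.eventually (gt_mem_nhds hε), mem_inf_of_right (mem_principal_self _)]
    with z hzε hz x hx
  have hxr : |x| ≤ r := by
    rw [abs_of_nonneg hx.1]
    exact hx.2
  have hsum : Summable fun n : ℕ => ((n : ℝ) + 1) * ‖jostCoeff lam z (n + 1)‖ * r ^ n :=
    Summable.of_nonneg_of_le (fun n => by positivity)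
      (norm_succ_mul_coeff_le hC0.le (by norm_num) hr0 (hbd z hz)) (hs.mul_left _)
  have hsum0 : Summable fun n => jostCoeff lam z n * (x : ℂ) ^ n :=
    (hs.mul_left C).of_norm_bounded fun n =>
      (norm_mul_ofReal_pow_le _ hxr n).trans
        (norm_coeff_mul_pow_le hC0.le (by norm_num) hr0 (hbd z hz) n)
  constructor
  · rw [hyp, hsum0.tsum_eq_zero_add, jostCoeff_zero, pow_zero, mul_one, add_sub_cancel_left]
    refine (tsum_of_norm_bounded hsum.hasSum fun n => ?_).trans hzε.le
    refine (norm_mul_ofReal_pow_le _ hxr (n + 1)).trans ?_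
    rw [pow_succ, ← mul_assoc]
    have h1 : ‖jostCoeff lam z (n + 1)‖ * r ^ n * r ≤ ‖jostCoeff lam z (n + 1)‖ * r ^ n * 1 := by
      gcongr
      linarith
    have h2 : 0 ≤ (n : ℝ) * (‖jostCoeff lam z (n + 1)‖ * r ^ n) := by positivity
    linarith
  · refine (tsum_of_norm_bounded hsum.hasSum fun n => ?_).trans hzε.le
    refine (norm_mul_ofReal_pow_le _ hxr n).trans ?_
    rw [norm_succ_mul]

/-! ### The unperturbed Jost solution near infinity in the sector -/

/-- Neighbourhoods of infinity in the sector, away from the poles. -/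
def sectorFilter (δ η : ℝ) : Filter ℂ := comap norm atTop ⊓ 𝓟 (sectorOne δ \ discs η)

instance : (sectorFilter δ η).IsCountablyGenerated := by
  unfold sectorFilter
  infer_instance

lemma norm_le_of_mem_sectorOne {z : ℂ} (hz : z ∈ sectorOne δ) : ‖z‖ ≤ (1 + δ) * -z.im := by
  have h1 := Complex.norm_le_abs_re_add_abs_im z
  have h2 : -|z.re| ≥ δ * z.im := hz.2
  rw [abs_of_neg hz.1] at h1
  linarith

lemma eventually_mem_sectorFilter : ∀ᶠ z in sectorFilter δ η, z ∈ sectorOne δ \ discs η :=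
  mem_inf_of_right (mem_principal_self _)

lemma tendsto_norm_sectorFilter : Tendsto (fun z : ℂ => ‖z‖) (sectorFilter δ η) atTop :=
  tendsto_comap.mono_left inf_le_left

lemma tendsto_neg_im_sectorFilter (hδ : 0 < δ) :
    Tendsto (fun z : ℂ => -z.im) (sectorFilter δ η) atTop := by
  have h1 : Tendsto (fun z : ℂ => ‖z‖ / (1 + δ)) (sectorFilter δ η) atTop :=
    tendsto_norm_sectorFilter.atTop_div_const (by linarith)
  refine tendsto_atTop_mono' _ ?_ h1
  filter_upwards [eventually_mem_sectorFilter] with z hz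
  rw [div_le_iff₀ (by linarith), mul_comm]
  exact norm_le_of_mem_sectorOne hz.1

lemma eventually_mem_goodSet (hδ : 0 < δ) : ∀ᶠ z in sectorFilter δ η, z ∈ goodSet η := by
  filter_upwards [eventually_mem_sectorFilter,
    (tendsto_neg_im_sectorFilter hδ).eventually (eventually_ge_atTop 1)] with z hz hz1
  exact ⟨by linarith, hz.2⟩

lemma sectorFilter_le (hδ : 0 < δ) : sectorFilter δ η ≤ comap norm atTop ⊓ 𝓟 (goodSet η) :=
  le_inf inf_le_left (le_principal_iff.2 (eventually_mem_goodSet hδ))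

/-- The argument of the hypergeometric function in the unperturbed Jost solution. -/
def logisticArg (x : ℝ) : ℝ := 1 / (1 + Real.exp (2 * x))

/-- The derivative of `logisticArg`. -/
def logisticArgDeriv (x : ℝ) : ℝ := -(2 * Real.exp (2 * x)) / (1 + Real.exp (2 * x)) ^ 2

lemma hasDerivAt_logisticArg (x : ℝ) : HasDerivAt logisticArg (logisticArgDeriv x) x := by
  have h1 : HasDerivAt (fun x : ℝ => 1 + Real.exp (2 * x)) (Real.exp (2 * x) * 2) x := by
    have := ((hasDerivAt_id x).const_mul 2).exp.const_add 1
    simpa using this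
  have h2 := (hasDerivAt_const x (1 : ℝ)).fun_div h1 (by positivity)
  refine h2.congr_deriv ?_
  rw [logisticArgDeriv]
  ring

lemma continuous_logisticArg : Continuous logisticArg :=
  continuous_iff_continuousAt.2 fun x => (hasDerivAt_logisticArg x).continuousAt

lemma continuous_logisticArgDeriv : Continuous logisticArgDeriv := by
  unfold logisticArgDeriv
  exact Continuous.div (by fun_prop) (by fun_prop) fun x => by positivity

lemma logisticArg_pos (x : ℝ) : 0 < logisticArg x := by
  unfold logisticArg
  positivity

lemma logisticArg_lt_one (x : ℝ) : |logisticArg x| < 1 := by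
  rw [abs_of_pos (logisticArg_pos x), logisticArg, div_lt_one (by positivity)]
  linarith [Real.exp_pos (2 * x)]

lemma logisticArg_anti {x y : ℝ} (h : x ≤ y) : logisticArg y ≤ logisticArg x := by
  unfold logisticArg
  gcongr

lemma logisticArg_zero : logisticArg 0 = 1 / 2 := by
  norm_num [logisticArg]

lemma logisticArg_lt_half {x : ℝ} (h : 0 < x) : logisticArg x < 1 / 2 := by
  rw [logisticArg, div_lt_div_iff₀ (by positivity) (by norm_num)]
  have : 1 < Real.exp (2 * x) := Real.one_lt_exp_iff.2 (by linarith)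
  linarith

lemma abs_logisticArgDeriv_le_one (x : ℝ) : |logisticArgDeriv x| ≤ 1 := by
  have he := Real.exp_pos (2 * x)
  rw [logisticArgDeriv, abs_div, abs_neg, abs_of_pos (by positivity), abs_of_pos (by positivity),
    div_le_one (by positivity)]
  nlinarith

/-- The unperturbed Jost solution at `2 τ` without its exponential factor. -/
def amp (lam τ : ℝ) (z : ℂ) : ℂ := hyp lam z (logisticArg (2 * τ))

/-- The derivative of the unperturbed Jost solution at `2 τ`, divided by `i z`, without its
exponential factor. -/
def ampDeriv (lam τ : ℝ) (z : ℂ) : ℂ :=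
  amp lam τ z + hypDeriv lam z (logisticArg (2 * τ)) *
    (logisticArgDeriv (2 * τ) / (Complex.I * z))

/-- The derivative in `x` of the unperturbed Jost solution. -/
def jostFreeDeriv (lam x : ℝ) (z : ℂ) : ℂ :=
  Complex.exp (Complex.I * z * x) * (Complex.I * z * hyp lam z (logisticArg x) +
    logisticArgDeriv x * hypDeriv lam z (logisticArg x))

lemma hasDerivAt_jostFreePlus (hη : 0 < η) {z : ℂ} (hz : z ∈ goodSet η) (x : ℝ) :
    HasDerivAt (fun y => jostFreePlus lam y z) (jostFreeDeriv lam x z) x := by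
  have h1 := (hasDerivAt_hyp (lam := lam) hη hz (logisticArg_lt_one x)).scomp x
    (hasDerivAt_logisticArg x)
  have h2 : HasDerivAt (fun y : ℝ => Complex.exp (Complex.I * z * y))
      (Complex.exp (Complex.I * z * x) * (Complex.I * z)) x := by
    have := ((hasDerivAt_id (x : ℂ)).const_mul (Complex.I * z)).cexp.comp_ofReal
    simpa using this
  have h3 := h2.fun_mul h1
  have e : (fun y => jostFreePlus lam y z) = fun y : ℝ =>
      Complex.exp (Complex.I * z * y) * (hyp lam z ∘ logisticArg) y := by
    ext y
    exact jostFreePlus_eq lam y z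
  rw [e]
  refine h3.congr_deriv ?_
  rw [jostFreeDeriv, Complex.real_smul]
  simp only [Function.comp_apply]
  ring

lemma continuous_hyp_logisticArg (hη : 0 < η) {z : ℂ} (hz : z ∈ goodSet η) :
    Continuous fun x => hyp lam z (logisticArg x) :=
  continuous_iff_continuousAt.2 fun x =>
    (hasDerivAt_hyp hη hz (logisticArg_lt_one x)).continuousAt.comp
      continuous_logisticArg.continuousAt

lemma continuous_hypDeriv_logisticArg (hη : 0 < η) {z : ℂ} (hz : z ∈ goodSet η) :
    Continuous fun x => hypDeriv lam z (logisticArg x) :=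
  continuous_iff_continuousAt.2 fun x =>
    ContinuousAt.comp (continuousAt_hypDeriv hη hz (logisticArg_lt_one x))
      continuous_logisticArg.continuousAt

lemma continuous_jostFreeDeriv (hη : 0 < η) {z : ℂ} (hz : z ∈ goodSet η) :
    Continuous fun x => jostFreeDeriv lam x z := by
  have h1 := continuous_hyp_logisticArg (lam := lam) hη hz
  have h2 := continuous_hypDeriv_logisticArg (lam := lam) hη hz
  have h3 := continuous_logisticArgDeriv
  unfold jostFreeDeriv
  fun_prop

lemma jostFreePlus_two_mul (lam τ : ℝ) (z : ℂ) : jostFreePlus lam (2 * τ) z =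
    Complex.exp (2 * Complex.I * z * τ) * amp lam τ z := by
  rw [jostFreePlus_eq]
  congr 2
  push_cast
  ring

lemma jostFreeDeriv_two_mul (lam τ : ℝ) {z : ℂ} (hz : z ≠ 0) : jostFreeDeriv lam (2 * τ) z =
    Complex.I * z * (Complex.exp (2 * Complex.I * z * τ) * ampDeriv lam τ z) := by
  have hI := Complex.I_ne_zero
  have e : Complex.I * z * ((2 * τ : ℝ) : ℂ) = 2 * Complex.I * z * τ := by
    push_cast
    ring
  rw [jostFreeDeriv, e, ampDeriv, amp]
  field_simp

/-- Conditions on an amplitude `A` under which the exponential integrals over `[0, β]` with this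
amplitude have the same leading asymptotics along `l` as those with the amplitude `1`: away from
`β` some exponential growth is permitted. -/
structure IsUnitAmplitude (l : Filter ℂ) (β : ℝ) (A : ℝ → ℂ → ℂ) : Prop where
  continuous : ∀ᶠ z in l, Continuous fun τ => A τ z
  bound : ∃ M, 0 ≤ M ∧ ∀ᶠ z in l, ∀ τ ∈ Icc 0 β, ‖A τ z‖ ≤ M * Real.exp (-z.im * (β - τ))
  tendsto : ∀ ε > 0, ∀ᶠ z in l, ∀ τ ∈ Icc (β / 2) β, ‖A τ z - 1‖ ≤ ε

/-- A common bound for the hypergeometric factor and its derivative. -/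
lemma exists_norm_hyp_logisticArg_le (lam : ℝ) (hη : 0 < η) (hβ : 0 < β) :
    ∃ M, 0 ≤ M ∧ ∀ z ∈ goodSet η, ∀ τ ∈ Icc 0 (β / 2),
      ‖hyp lam z (logisticArg (2 * τ))‖ ≤ M * Real.exp (-z.im * (β - τ)) ∧
      ‖hypDeriv lam z (logisticArg (2 * τ))‖ ≤ M * Real.exp (-z.im * (β - τ)) := by
  have hexp : Real.exp (-(β / 2)) < 1 := Real.exp_lt_one_iff.2 (by linarith)
  obtain ⟨M, hM⟩ := exists_norm_hyp_le lam hη (ρ := β / 2) (r := 1 / 2) (by linarith)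
    (by norm_num) (by linarith)
  refine ⟨|M|, abs_nonneg M, fun z hz τ hτ => ?_⟩
  have hx : logisticArg (2 * τ) ∈ Icc 0 (1 / 2) := by
    refine ⟨(logisticArg_pos _).le, ?_⟩
    rw [← logisticArg_zero]
    exact logisticArg_anti (by linarith [hτ.1])
  have hle : M * Real.exp (β / 2 * -z.im) ≤ |M| * Real.exp (-z.im * (β - τ)) := by
    have h1 := hz.1
    have h2 := hτ.2
    refine mul_le_mul (le_abs_self M) (Real.exp_le_exp.2 ?_) (Real.exp_pos _).le (abs_nonneg M)
    nlinarith
  exact ⟨(hM z hz _ hx).1.trans hle, (hM z hz _ hx).2.trans hle⟩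

lemma eventually_amp_near (lam : ℝ) (hδ : 0 < δ) (hη : 0 < η) (hβ : 0 < β) {ε : ℝ} (hε : 0 < ε) :
    ∀ᶠ z in sectorFilter δ η, ∀ τ ∈ Icc (β / 2) β,
      ‖amp lam τ z - 1‖ ≤ ε ∧ ‖hypDeriv lam z (logisticArg (2 * τ))‖ ≤ ε := by
  filter_upwards [(eventually_norm_hyp_sub_one_le lam hη (logisticArg_pos β).le
    (logisticArg_lt_half hβ) hε).filter_mono (sectorFilter_le hδ)] with z hz τ hτ
  exact hz _ ⟨(logisticArg_pos _).le, logisticArg_anti (by linarith [hτ.1])⟩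

lemma isUnitAmplitude_amp (lam : ℝ) (hδ : 0 < δ) (hη : 0 < η) (hβ : 0 < β) :
    IsUnitAmplitude (sectorFilter δ η) β (amp lam) where
  continuous := by
    filter_upwards [eventually_mem_goodSet hδ] with z hz
    exact (continuous_hyp_logisticArg hη hz).comp (by fun_prop : Continuous fun τ : ℝ => 2 * τ)
  bound := by
    obtain ⟨M, hM0, hM⟩ := exists_norm_hyp_logisticArg_le lam hη hβ
    refine ⟨M + 2, by linarith, ?_⟩
    filter_upwards [eventually_mem_goodSet hδ, eventually_amp_near lam hδ hη hβ one_pos]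
      with z hz hz1 τ hτ
    rcases le_total τ (β / 2) with h | h
    · refine ((hM z hz τ ⟨hτ.1, h⟩).1).trans ?_
      gcongr
      linarith
    · have h1 := (hz1 τ ⟨h, hτ.2⟩).1
      have h2 : 1 ≤ Real.exp (-z.im * (β - τ)) :=
        Real.one_le_exp (mul_nonneg (by linarith [hz.1]) (by linarith [hτ.2]))
      have h3 := norm_sub_norm_le (amp lam τ z) 1
      rw [norm_one] at h3
      nlinarith
  tendsto := by
    intro ε hε
    filter_upwards [eventually_amp_near lam hδ hη hβ hε] with z hz τ hτ using (hz τ hτ).1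

lemma norm_ampDeriv_sub_amp_le (lam τ : ℝ) {z : ℂ} (hz : 1 ≤ ‖z‖) :
    ‖ampDeriv lam τ z - amp lam τ z‖ ≤ ‖hypDeriv lam z (logisticArg (2 * τ))‖ := by
  rw [ampDeriv, add_sub_cancel_left, norm_mul, norm_div, norm_mul, Complex.norm_I, one_mul,
    Complex.norm_real, Real.norm_eq_abs]
  refine mul_le_of_le_one_right (norm_nonneg _) ?_
  exact div_le_one_of_le₀ ((abs_logisticArgDeriv_le_one _).trans hz) (norm_nonneg _)

lemma isUnitAmplitude_ampDeriv (lam : ℝ) (hδ : 0 < δ) (hη : 0 < η) (hβ : 0 < β) :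
    IsUnitAmplitude (sectorFilter δ η) β (ampDeriv lam) where
  continuous := by
    filter_upwards [eventually_mem_goodSet hδ] with z hz
    have h1 := continuous_hyp_logisticArg (lam := lam) hη hz
    have h2 := continuous_hypDeriv_logisticArg (lam := lam) hη hz
    have h3 := continuous_logisticArgDeriv
    have h : Continuous fun x => hyp lam z (logisticArg x) +
        hypDeriv lam z (logisticArg x) * (logisticArgDeriv x / (Complex.I * z)) := by
      fun_prop
    exact h.comp (by fun_prop : Continuous fun τ : ℝ => 2 * τ)
  bound := by
    obtain ⟨M, hM0, hM⟩ := exists_norm_hyp_logisticArg_le lam hη hβ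
    refine ⟨2 * M + 3, by linarith, ?_⟩
    filter_upwards [eventually_mem_goodSet hδ, eventually_amp_near lam hδ hη hβ one_pos,
      tendsto_norm_sectorFilter.eventually (eventually_ge_atTop 1)] with z hz hz1 hzn τ hτ
    have h0 := norm_ampDeriv_sub_amp_le lam τ hzn
    have h4 := norm_sub_norm_le (ampDeriv lam τ z) (amp lam τ z)
    have h2 : 1 ≤ Real.exp (-z.im * (β - τ)) :=
      Real.one_le_exp (mul_nonneg (by linarith [hz.1]) (by linarith [hτ.2]))
    rcases le_total τ (β / 2) with h | h
    · obtain ⟨h5, h6⟩ := hM z hz τ ⟨hτ.1, h⟩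
      rw [← amp] at h5
      linarith
    · obtain ⟨h5, h6⟩ := hz1 τ ⟨h, hτ.2⟩
      have h3 := norm_sub_norm_le (amp lam τ z) 1
      rw [norm_one] at h3
      nlinarith
  tendsto := by
    intro ε hε
    filter_upwards [eventually_amp_near lam hδ hη hβ (half_pos hε),
      tendsto_norm_sectorFilter.eventually (eventually_ge_atTop 1)] with z hz hzn τ hτ
    have h0 := norm_ampDeriv_sub_amp_le lam τ hzn
    obtain ⟨h1, h2⟩ := hz τ hτ
    have h3 := norm_sub_le_norm_sub_add_norm_sub (ampDeriv lam τ z) (amp lam τ z) 1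
    linarith

/-! ### Exponential integrals -/

lemma integrableOn_pow_mul_exp_neg_mul (P : ℕ) {b : ℝ} (hb : 0 < b) :
    IntegrableOn (fun s : ℝ => s ^ P * Real.exp (-(b * s))) (Ioi 0) := by
  have h := integrableOn_rpow_mul_exp_neg_mul_rpow (p := 1) (s := P) (b := b)
    (by linarith [Nat.cast_nonneg (α := ℝ) P]) one_pos hb
  simpa [Real.rpow_natCast] using h

lemma norm_cexp_neg_mul {ζ : ℂ} (hζ : ζ.re = 1) (s : ℝ) :
    ‖Complex.exp (-(ζ * s))‖ = Real.exp (-s) := by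
  rw [Complex.norm_exp]
  simp [hζ]

lemma integrableOn_pow_mul_cexp_neg_mul (P : ℕ) {ζ : ℂ} (hζ : ζ.re = 1) :
    IntegrableOn (fun s : ℝ => (s : ℂ) ^ P * Complex.exp (-(ζ * s))) (Ioi 0) := by
  have h := integrableOn_pow_mul_exp_neg_mul P one_pos
  refine Integrable.mono' h (Continuous.aestronglyMeasurable (by fun_prop)) ?_
  refine (ae_restrict_iff' measurableSet_Ioi).2 (Eventually.of_forall fun s hs => ?_)
  rw [norm_mul, norm_cexp_neg_mul hζ, norm_pow, Complex.norm_real,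
    Real.norm_of_nonneg (le_of_lt hs), one_mul]

lemma integral_pow_mul_cexp_neg_mul (P : ℕ) {ζ : ℂ} (hζ : ζ.re = 1) :
    ζ ^ (P + 1) * ∫ s in Ioi (0 : ℝ), (s : ℂ) ^ P * Complex.exp (-(ζ * s)) = P.factorial := by
  have hζ0 : ζ ≠ 0 := by
    rintro rfl
    simp at hζ
  induction P with
  | zero =>
    have h := integral_exp_mul_complex_Ioi (a := -ζ) (by simp [hζ]) 0
    simp only [neg_mul] at h
    simp only [pow_zero, one_mul, h]
    simp [hζ0]
  | succ P ih =>
    have hd : ∀ s : ℝ, HasDerivAt (fun s : ℝ => (s : ℂ) ^ (P + 1) * Complex.exp (-(ζ * s)))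
        (((P : ℂ) + 1) * ((s : ℂ) ^ P * Complex.exp (-(ζ * s))) -
          ζ * ((s : ℂ) ^ (P + 1) * Complex.exp (-(ζ * s)))) s := by
      intro s
      have h1 := hasDerivAt_pow (P + 1) (s : ℂ)
      have h2 := ((hasDerivAt_id (s : ℂ)).const_mul ζ).fun_neg.cexp
      have h3 := (h1.fun_mul h2).comp_ofReal
      refine h3.congr_deriv ?_
      simp only [id, Nat.add_sub_cancel]
      push_cast
      ring
    have hi1 := integrableOn_pow_mul_cexp_neg_mul P hζ
    have hi2 := integrableOn_pow_mul_cexp_neg_mul (P + 1) hζ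
    have hlim : Tendsto (fun s : ℝ => (s : ℂ) ^ (P + 1) * Complex.exp (-(ζ * s))) atTop (𝓝 0) := by
      refine squeeze_zero_norm' ?_ (Real.tendsto_pow_mul_exp_neg_atTop_nhds_zero (P + 1))
      filter_upwards [eventually_ge_atTop 0] with s hs
      rw [norm_mul, norm_cexp_neg_mul hζ, norm_pow, Complex.norm_real, Real.norm_of_nonneg hs]
    have h4 := integral_Ioi_of_hasDerivAt_of_tendsto' (a := 0) (fun s _ => hd s)
      ((hi1.const_mul ((P : ℂ) + 1)).sub (hi2.const_mul ζ)) hlim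
    rw [MeasureTheory.integral_sub (hi1.const_mul _) (hi2.const_mul _),
      MeasureTheory.integral_const_mul, MeasureTheory.integral_const_mul] at h4
    simp only [Complex.ofReal_zero, ne_eq, Nat.succ_ne_zero, not_false_eq_true, zero_pow, zero_mul,
      sub_zero] at h4
    rw [Nat.factorial_succ, pow_succ, mul_assoc, ← sub_eq_zero.1 h4]
    push_cast
    rw [← ih]
    ring

/-- The rescaled integrand near the end point `β`, cut off outside `[0, β]`; here
`s = -2 (Im z) (β - τ)`. -/
def rescaled (β : ℝ) (P : ℕ) (k : ℝ → ℝ) (A : ℝ → ℂ → ℂ) (z : ℂ) : ℝ → ℂ :=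
  indicator (Ioc 0 (2 * -z.im * β)) fun s =>
    (((2 * -z.im) ^ P * k (β - s / (2 * -z.im)) : ℝ) : ℂ) * A (β - s / (2 * -z.im)) z

section Laplace

variable {l : Filter ℂ} {A : ℝ → ℂ → ℂ} {k : ℝ → ℝ} {P : ℕ} {c D : ℝ}

lemma integrable_rescaled_mul (hk : Continuous k) {z : ℂ} (hA : Continuous fun τ => A τ z)
    {g : ℝ → ℂ} (hg : Continuous g) :
    Integrable (fun s => rescaled β P k A z s * g s) := by
  have hc : Continuous fun s : ℝ =>
      (((2 * -z.im) ^ P * k (β - s / (2 * -z.im)) : ℝ) : ℂ) * A (β - s / (2 * -z.im)) z := by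
    have : Continuous fun s : ℝ => A (β - s / (2 * -z.im)) z :=
      hA.comp (by fun_prop : Continuous fun s : ℝ => β - s / (2 * -z.im))
    fun_prop
  have h := ((hc.mul hg).integrableOn_Icc (a := 0) (b := 2 * -z.im * β)).mono_set
    (Ioc_subset_Icc_self) (μ := volume)
  rw [← integrable_indicator_iff measurableSet_Ioc] at h
  refine h.congr (Eventually.of_forall fun s => ?_)
  simp only [rescaled, indicator_apply]
  split_ifs <;> simp

/-- The exponential integral in terms of the rescaled integrand. The scaling by `2 z / (-2 Im z)`
keeps the exponential of modulus `exp (-s)`. -/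
lemma exp_integral_eq_rescaled {z : ℂ} (hz : 0 < -z.im) (hβ : 0 < β) :
    (2 * Complex.I * z) ^ (P + 1) * Complex.exp (-(2 * Complex.I * z * β)) *
      ∫ τ in (0 : ℝ)..β, (k τ : ℂ) * (Complex.exp (2 * Complex.I * z * τ) * A τ z) =
    (2 * Complex.I * z / (2 * -z.im : ℝ)) ^ (P + 1) * ∫ s in Ioi (0 : ℝ), rescaled β P k A z s *
      Complex.exp (-(2 * Complex.I * z / (2 * -z.im : ℝ) * s)) := by
  obtain ⟨w, hw⟩ : ∃ w : ℝ, w = 2 * -z.im := ⟨_, rfl⟩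
  have hw0 : 0 < w := by linarith
  have hwβ : 0 ≤ w * β := by positivity
  have hwC : (w : ℂ) ≠ 0 := by exact_mod_cast hw0.ne'
  have h1 : ∫ s in Ioi (0 : ℝ), rescaled β P k A z s *
      Complex.exp (-(2 * Complex.I * z / (w : ℝ) * s)) =
      ∫ s in (0 : ℝ)..(w * β), ((w ^ P * k (β - s / w) : ℝ) : ℂ) * A (β - s / w) z *
        Complex.exp (-(2 * Complex.I * z * ((β : ℂ) - ((β - s / w : ℝ) : ℂ)))) := by
    rw [integral_of_le hwβ]
    have h2 : ∀ s, rescaled β P k A z s * Complex.exp (-(2 * Complex.I * z / (w : ℝ) * s)) =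
        indicator (Ioc 0 (w * β)) (fun s => ((w ^ P * k (β - s / w) : ℝ) : ℂ) *
          A (β - s / w) z * Complex.exp (-(2 * Complex.I * z *
            ((β : ℂ) - ((β - s / w : ℝ) : ℂ))))) s := by
      intro s
      simp only [rescaled, ← hw, indicator_apply]
      split_ifs
      · congr 3
        push_cast
        field_simp
        ring
      · simp
    simp only [h2]
    rw [MeasureTheory.integral_indicator measurableSet_Ioc, Measure.restrict_restrict
      measurableSet_Ioc, inter_eq_self_of_subset_left Ioc_subset_Ioi_self]
  rw [← hw, h1, integral_comp_sub_div (fun τ : ℝ => ((w ^ P * k τ : ℝ) : ℂ) * A τ z *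
    Complex.exp (-(2 * Complex.I * z * ((β : ℂ) - (τ : ℂ))))) hw0.ne' β, zero_div, sub_zero,
    mul_div_cancel_left₀ β hw0.ne', sub_self, Complex.real_smul]
  have h3 : ∀ τ : ℝ, ((w ^ P * k τ : ℝ) : ℂ) * A τ z *
      Complex.exp (-(2 * Complex.I * z * ((β : ℂ) - (τ : ℂ)))) =
      ((w : ℂ) ^ P * Complex.exp (-(2 * Complex.I * z * β))) *
        ((k τ : ℂ) * (Complex.exp (2 * Complex.I * z * τ) * A τ z)) := by
    intro τ
    have : -(2 * Complex.I * z * ((β : ℂ) - (τ : ℂ))) =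
        -(2 * Complex.I * z * β) + 2 * Complex.I * z * τ := by ring
    rw [this, Complex.exp_add]
    push_cast
    ring
  simp only [h3]
  rw [intervalIntegral.integral_const_mul, div_pow, pow_succ (w : ℂ)]
  field_simp

/-- The rescaled integrand converges to `c s ^ P` in the weighted `L¹` norm, by dominated
convergence: the growth allowed by `IsUnitAmplitude` costs at most a factor `exp (s / 2)`. -/
lemma tendsto_integral_norm_rescaled_sub [l.IsCountablyGenerated] (hA : IsUnitAmplitude l β A)
    (hl : Tendsto (fun z : ℂ => -z.im) l atTop) (hβ : 0 < β) (hk : Continuous k)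
    (hkD : ∀ τ ∈ Icc 0 β, |k τ| ≤ D * (β - τ) ^ P)
    (hlim : Tendsto (fun τ => k τ / (β - τ) ^ P) (𝓝[<] β) (𝓝 c)) :
    Tendsto (fun z => ∫ s in Ioi (0 : ℝ), ‖rescaled β P k A z s - (c * s ^ P : ℝ)‖ *
      Real.exp (-s)) l (𝓝 0) := by
  obtain ⟨M, hM0, hM⟩ := hA.bound
  have hD0 : 0 ≤ D := by
    have := (abs_nonneg _).trans (hkD 0 ⟨le_rfl, hβ.le⟩)
    exact nonneg_of_mul_nonneg_left this (pow_pos (by linarith) _)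
  have hkey : Tendsto (fun z => ∫ s in Ioi (0 : ℝ),
      ‖rescaled β P k A z s - (c * s ^ P : ℝ)‖ * Real.exp (-s)) l
      (𝓝 (∫ _s in Ioi (0 : ℝ), (0 : ℝ))) := by
    refine tendsto_integral_filter_of_dominated_convergence
      (fun s => (D * M + |c|) * (s ^ P * Real.exp (-(1 / 2 * s)))) ?_ ?_
      ((integrableOn_pow_mul_exp_neg_mul P (by norm_num)).const_mul _) ?_
    · filter_upwards [hA.continuous] with z hz
      have h1 : AEStronglyMeasurable (rescaled β P k A z) volume := by
        have := (integrable_rescaled_mul (β := β) (P := P) hk hz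
          (continuous_const (y := (1 : ℂ)))).aestronglyMeasurable
        simpa using this
      have h2 : Continuous fun s : ℝ => ((c * s ^ P : ℝ) : ℂ) := by fun_prop
      exact (((h1.sub h2.aestronglyMeasurable).norm).mul
        (Continuous.aestronglyMeasurable (by fun_prop))).restrict
    · filter_upwards [hM, hl.eventually (eventually_gt_atTop 0)] with z hz hz0
      refine (ae_restrict_iff' measurableSet_Ioi).2 (Eventually.of_forall fun s hs => ?_)
      have hs0 : (0 : ℝ) ≤ s := le_of_lt hs
      rw [norm_mul, norm_norm, Real.norm_of_nonneg (Real.exp_pos _).le]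
      have hexp : Real.exp (s / 2) * Real.exp (-s) = Real.exp (-(1 / 2 * s)) := by
        rw [← Real.exp_add]
        congr 1
        ring
      have h1 : ‖rescaled β P k A z s‖ ≤ D * s ^ P * (M * Real.exp (s / 2)) := by
        rw [rescaled, indicator_apply]
        split_ifs with hmem
        · set w := 2 * -z.im with hw
          have hw0 : 0 < w := by linarith
          have hτ : β - s / w ∈ Icc 0 β := by
            have h2 : s / w ≤ β := by
              rw [div_le_iff₀ hw0, mul_comm]
              exact hmem.2
            exact ⟨by linarith, by linarith [div_nonneg hs0 hw0.le]⟩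
          have h3 := hkD _ hτ
          have h4 := hz _ hτ
          rw [sub_sub_cancel] at h3 h4
          have h5 : -z.im * (s / w) = s / 2 := by
            rw [mul_div_assoc', div_eq_iff hw0.ne', hw]
            ring
          rw [h5] at h4
          rw [norm_mul, Complex.norm_real, norm_mul, Real.norm_of_nonneg (by positivity),
            Real.norm_eq_abs]
          refine mul_le_mul ?_ h4 (norm_nonneg _) (by positivity)
          calc w ^ P * |k (β - s / w)| ≤ w ^ P * (D * (s / w) ^ P) := by gcongr
            _ = D * s ^ P := by
              rw [div_pow]
              field_simp
        · rw [norm_zero]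
          positivity
      have h6 : ‖((c * s ^ P : ℝ) : ℂ)‖ ≤ |c| * s ^ P * Real.exp (s / 2) := by
        rw [Complex.norm_real, norm_mul, Real.norm_eq_abs, Real.norm_of_nonneg (by positivity)]
        exact le_mul_of_one_le_right (by positivity) (Real.one_le_exp (by linarith))
      calc ‖rescaled β P k A z s - (c * s ^ P : ℝ)‖ * Real.exp (-s)
          ≤ (D * s ^ P * (M * Real.exp (s / 2)) + |c| * s ^ P * Real.exp (s / 2)) *
            Real.exp (-s) := by
            gcongr
            exact (norm_sub_le _ _).trans (add_le_add h1 h6)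
        _ = (D * M + |c|) * (s ^ P * (Real.exp (s / 2) * Real.exp (-s))) := by ring
        _ = _ := by rw [hexp]
    · refine (ae_restrict_iff' measurableSet_Ioi).2 (Eventually.of_forall fun s hs => ?_)
      have hs0 : (0 : ℝ) < s := hs
      have hw : Tendsto (fun z : ℂ => 2 * -z.im) l atTop := hl.const_mul_atTop two_pos
      have hτ : Tendsto (fun z : ℂ => β - s / (2 * -z.im)) l (𝓝[<] β) := by
        refine tendsto_nhdsWithin_iff.2 ⟨?_, ?_⟩
        · simpa using (hw.const_div_atTop s).const_sub β
        · filter_upwards [hw.eventually (eventually_gt_atTop 0)] with z hz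
          have := div_pos hs0 hz
          simp only [mem_Iio]
          linarith
      have hA1 : Tendsto (fun z => A (β - s / (2 * -z.im)) z) l (𝓝 1) := by
        refine Metric.tendsto_nhds.2 fun ε hε => ?_
        filter_upwards [hA.tendsto (ε / 2) (half_pos hε),
          hτ.eventually (Ico_mem_nhdsLT (by linarith : β / 2 < β))] with z hz hzτ
        rw [dist_eq_norm]
        exact (hz _ ⟨hzτ.1, hzτ.2.le⟩).trans_lt (half_lt_self hε)
      have hk1 : Tendsto (fun z : ℂ => (2 * -z.im) ^ P * k (β - s / (2 * -z.im))) l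
          (𝓝 (c * s ^ P)) := by
        refine ((hlim.comp hτ).mul_const (s ^ P)).congr' ?_
        filter_upwards [hw.eventually (eventually_gt_atTop 0)] with z hz
        simp only [Function.comp_apply, sub_sub_cancel, div_pow]
        field_simp
      have hprod := ((Complex.continuous_ofReal.tendsto _).comp hk1).mul hA1
      rw [mul_one] at hprod
      have hresc : Tendsto (fun z => rescaled β P k A z s) l (𝓝 ((c * s ^ P : ℝ) : ℂ)) := by
        refine hprod.congr' ?_
        filter_upwards [(hw.atTop_mul_const hβ).eventually (eventually_ge_atTop s)] with z hz
        rw [rescaled, indicator_of_mem (show s ∈ Ioc 0 (2 * -z.im * β) from ⟨hs0, hz⟩)]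
        rfl
      have := ((hresc.sub_const ((c * s ^ P : ℝ) : ℂ)).norm).mul_const (Real.exp (-s))
      simpa using this
  simpa using hkey

/-- Watson's lemma for the exponential integral of a kernel vanishing like `c (β - τ) ^ P` at the
end point where the exponential is largest. -/
lemma tendsto_exp_integral [l.IsCountablyGenerated] (hA : IsUnitAmplitude l β A)
    (hl : Tendsto (fun z : ℂ => -z.im) l atTop) {Λ : ℝ} (hΛ : ∀ᶠ z : ℂ in l, ‖z‖ ≤ Λ * -z.im)
    (hβ : 0 < β) (hk : Continuous k) (hkD : ∀ τ ∈ Icc 0 β, |k τ| ≤ D * (β - τ) ^ P)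
    (hlim : Tendsto (fun τ => k τ / (β - τ) ^ P) (𝓝[<] β) (𝓝 c)) :
    Tendsto (fun z : ℂ => (2 * Complex.I * z) ^ (P + 1) * Complex.exp (-(2 * Complex.I * z * β)) *
      ∫ τ in (0 : ℝ)..β, (k τ : ℂ) * (Complex.exp (2 * Complex.I * z * τ) * A τ z)) l
      (𝓝 (c * P.factorial)) := by
  have h0 := tendsto_integral_norm_rescaled_sub hA hl hβ hk hkD hlim
  have h1 := h0.const_mul (Λ ^ (P + 1))
  rw [mul_zero] at h1
  rw [tendsto_iff_norm_sub_tendsto_zero]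
  refine squeeze_zero' (Eventually.of_forall fun _ => norm_nonneg _) ?_ h1
  filter_upwards [hA.continuous, hΛ, hl.eventually (eventually_gt_atTop 0)] with z hzc hzΛ hz
  obtain ⟨ζ, hζ⟩ : ∃ ζ : ℂ, ζ = 2 * Complex.I * z / (2 * -z.im : ℝ) := ⟨_, rfl⟩
  have hζre : ζ.re = 1 := by
    rw [hζ, Complex.div_ofReal_re]
    simp only [Complex.mul_re, Complex.mul_im, Complex.I_re, Complex.I_im, Complex.re_ofNat,
      Complex.im_ofNat]
    rw [div_eq_one_iff_eq (by linarith)]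
    ring
  have hζn : ‖ζ‖ ≤ Λ := by
    rw [hζ, norm_div, norm_mul, norm_mul, Complex.norm_I, Complex.norm_real, Complex.norm_ofNat,
      Real.norm_of_nonneg (by linarith), mul_one, mul_div_mul_left _ _ two_ne_zero,
      div_le_iff₀ hz]
    exact hzΛ
  have hi1 : IntegrableOn (fun s => rescaled β P k A z s * Complex.exp (-(ζ * s))) (Ioi 0) :=
    (integrable_rescaled_mul hk hzc (by fun_prop)).integrableOn
  have hi2 := (integrableOn_pow_mul_cexp_neg_mul P hζre).const_mul (c : ℂ)
  have hc := integral_pow_mul_cexp_neg_mul P hζre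
  have hdiff : ζ ^ (P + 1) * (∫ s in Ioi (0 : ℝ), rescaled β P k A z s *
      Complex.exp (-(ζ * s))) - c * P.factorial =
      ζ ^ (P + 1) * ∫ s in Ioi (0 : ℝ), (rescaled β P k A z s - (c * s ^ P : ℝ)) *
        Complex.exp (-(ζ * s)) := by
    have h2 : ∀ s : ℝ, (rescaled β P k A z s - (c * s ^ P : ℝ)) * Complex.exp (-(ζ * s)) =
        rescaled β P k A z s * Complex.exp (-(ζ * s)) -
          c * ((s : ℂ) ^ P * Complex.exp (-(ζ * s))) := by
      intro s
      push_cast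
      ring
    simp only [h2]
    rw [MeasureTheory.integral_sub hi1 hi2, MeasureTheory.integral_const_mul, ← hc]
    ring
  rw [exp_integral_eq_rescaled hz hβ, ← hζ, hdiff, norm_mul, norm_pow]
  have h3 : ‖∫ s in Ioi (0 : ℝ), (rescaled β P k A z s - (c * s ^ P : ℝ)) *
      Complex.exp (-(ζ * s))‖ ≤
      ∫ s in Ioi (0 : ℝ), ‖rescaled β P k A z s - (c * s ^ P : ℝ)‖ * Real.exp (-s) := by
    refine (MeasureTheory.norm_integral_le_integral_norm _).trans (le_of_eq ?_)
    simp only [norm_mul, norm_cexp_neg_mul hζre]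
  exact mul_le_mul (pow_le_pow_left₀ (norm_nonneg _) hζn _) h3 (norm_nonneg _)
    (pow_nonneg ((norm_nonneg _).trans hζn) _)

end Laplace

/-! ### Asymptotics of the perturbed Jost solution -/

lemma norm_exp_normalizer (β : ℝ) (z : ℂ) :
    ‖Complex.exp (-(2 * Complex.I * z * β))‖ = Real.exp (-(2 * -z.im * β)) := by
  rw [Complex.norm_exp]
  congr 1
  simp

/-- Boundary terms at `τ = 0` are negligible after the normalization. -/
lemma tendsto_normalizer_mul_zero {l : Filter ℂ} {A : ℝ → ℂ → ℂ} (hA : IsUnitAmplitude l β A)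
    (hl : Tendsto (fun z : ℂ => -z.im) l atTop) {Λ : ℝ} (hΛ : ∀ᶠ z : ℂ in l, ‖z‖ ≤ Λ * -z.im)
    (hβ : 0 < β) (m : ℕ) :
    Tendsto (fun z : ℂ => (2 * Complex.I * z) ^ m * Complex.exp (-(2 * Complex.I * z * β)) *
      A 0 z) l (𝓝 0) := by
  obtain ⟨M, hM0, hM⟩ := hA.bound
  have h1 : Tendsto (fun z : ℂ => (2 * Λ / β) ^ m * M * ((-z.im * β) ^ m *
      Real.exp (-(-z.im * β)))) l (𝓝 0) := by
    have := ((Real.tendsto_pow_mul_exp_neg_atTop_nhds_zero m).comp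
      (hl.atTop_mul_const hβ)).const_mul ((2 * Λ / β) ^ m * M)
    simpa using this
  refine squeeze_zero_norm' ?_ h1
  filter_upwards [hM, hΛ] with z hzM hzΛ
  have h2 := hzM 0 ⟨le_rfl, hβ.le⟩
  rw [sub_zero] at h2
  rw [norm_mul, norm_mul, norm_exp_normalizer, norm_pow, norm_mul, norm_mul, Complex.norm_I,
    Complex.norm_ofNat, mul_one]
  calc (2 * ‖z‖) ^ m * Real.exp (-(2 * -z.im * β)) * ‖A 0 z‖
      ≤ (2 * (Λ * -z.im)) ^ m * Real.exp (-(2 * -z.im * β)) *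
          (M * Real.exp (-z.im * β)) := by
        gcongr
        exact mul_nonneg (pow_nonneg (by linarith [norm_nonneg z]) _) (Real.exp_pos _).le
    _ = (2 * (Λ * -z.im)) ^ m * M *
          (Real.exp (-(2 * -z.im * β)) * Real.exp (-z.im * β)) := by ring
    _ = (2 * Λ / β) ^ m * M * ((-z.im * β) ^ m * Real.exp (-(-z.im * β))) := by
        rw [← Real.exp_add, show -(2 * -z.im * β) + -z.im * β = -(-z.im * β) by ring,
          show 2 * (Λ * -z.im) = 2 * Λ / β * (-z.im * β) by field_simp, mul_pow (2 * Λ / β)]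
        ring

lemma jostPlus_at_zero (hβ : 0 < β) (z : ℂ) : jostPlus lam q β 0 z = amp lam 0 z +
    2 * ∫ τ in (0 : ℝ)..β, ((charKernel lam q β τ τ : ℝ) : ℂ) *
      (Complex.exp (2 * Complex.I * z * τ) * amp lam τ z) := by
  have h0 := jostFreePlus_two_mul lam 0 z
  simp only [mul_zero, Complex.ofReal_zero, Complex.exp_zero, one_mul] at h0
  rw [jostPlus, if_pos hβ, integral_kernelPlus_mul, h0]
  simp only [sub_zero, jostFreePlus_two_mul]

lemma deriv_jostPlus_at_zero (hq : Integrable q) (hβ : 0 < β) (hη : 0 < η) {z : ℂ}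
    (hz : z ∈ goodSet η) (hz0 : z ≠ 0) :
    deriv (fun x => jostPlus lam q β x z) 0 = Complex.I * z * ampDeriv lam 0 z +
      -2 * ((∫ τ in (0 : ℝ)..β, ((charKernelSlope lam q β τ τ : ℝ) : ℂ) *
          (Complex.exp (2 * Complex.I * z * τ) * amp lam τ z)) +
        Complex.I * z * (∫ τ in (0 : ℝ)..β, ((charKernel lam q β τ τ : ℝ) : ℂ) *
          (Complex.exp (2 * Complex.I * z * τ) * ampDeriv lam τ z)) +
        ((charKernel lam q β 0 0 : ℝ) : ℂ) * amp lam 0 z) := by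
  have h0 := jostFreePlus_two_mul lam 0 z
  have h0' := jostFreeDeriv_two_mul lam 0 hz0
  simp only [mul_zero, Complex.ofReal_zero, Complex.exp_zero, one_mul] at h0 h0'
  have h1 := (hasDerivAt_jostFreePlus (lam := lam) hη hz 0).fun_add
    (hasDerivAt_integral_kernelPlus_mul (lam := lam) (β := β) hq
      (hasDerivAt_jostFreePlus (lam := lam) hη hz) (continuous_jostFreeDeriv hη hz))
  have h2 : (fun x => jostPlus lam q β x z) =ᶠ[𝓝 0] fun x => jostFreePlus lam x z +
      ∫ t in x..(2 * β - x), ((kernelPlus lam q β x t : ℝ) : ℂ) * jostFreePlus lam t z := by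
    filter_upwards [Iio_mem_nhds hβ] with x hx
    rw [jostPlus, if_pos (mem_Iio.1 hx)]
  rw [h2.deriv_eq, h1.deriv, h0, h0']
  simp only [jostFreePlus_two_mul, jostFreeDeriv_two_mul _ _ hz0]
  congr 4
  rw [← intervalIntegral.integral_const_mul]
  congr 1
  ext τ
  ring

/-- Near infinity in the sector, the contribution of the right edge of the support dominates the
Jost solution at `0`: up to an explicit factor it tends to a nonzero constant `L`, and its
derivative behaves like `-i z` times the solution, as for the reflected wave
`exp (i z (2 β - x))`. -/
lemma exists_jostPlus_asymptotics (hq : Integrable q) (hq0 : ∀ x, β < x → q x = 0) (hβ : 0 < β)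
    {k : ℕ} (hjump : DerivJumpAt k q β) (hδ : 0 < δ) (hη : 0 < η) :
    ∃ m : ℕ, ∃ L : ℂ, L ≠ 0 ∧
      Tendsto (fun z : ℂ => (2 * Complex.I * z) ^ m * Complex.exp (-(2 * Complex.I * z * β)) *
        jostPlus lam q β 0 z) (sectorFilter δ η) (𝓝 L) ∧
      Tendsto (fun z : ℂ => (2 * Complex.I * z) ^ m * Complex.exp (-(2 * Complex.I * z * β)) *
        (deriv (fun x => jostPlus lam q β x z) 0 / (Complex.I * z))) (sectorFilter δ η)
        (𝓝 (-L)) := by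
  obtain ⟨P, c, hc, D, hlim, hD⟩ := exists_charKernel_asymptotics (lam := lam) hq hq0 hβ hjump
  have hl := tendsto_neg_im_sectorFilter (δ := δ) (η := η) hδ
  have hΛ : ∀ᶠ z in sectorFilter δ η, ‖z‖ ≤ (1 + δ) * -z.im :=
    eventually_mem_sectorFilter.mono fun z hz => norm_le_of_mem_sectorOne hz.1
  have hA := isUnitAmplitude_amp lam hδ hη hβ
  have hA' := isUnitAmplitude_ampDeriv lam hδ hη hβ
  have hKc : Continuous fun τ => charKernel lam q β τ τ :=
    continuous_diag (continuous_charKernel hq)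
  have hGc : Continuous fun τ => charKernelSlope lam q β τ τ :=
    continuous_diag (continuous_charKernelSlope hq)
  have hK1 := tendsto_exp_integral hA hl hΛ hβ hKc (fun τ hτ => (hD τ hτ).1) hlim
  have hK2 := tendsto_exp_integral hA' hl hΛ hβ hKc (fun τ hτ => (hD τ hτ).1) hlim
  -- The slope also is `O((β - τ) ^ (P + 1))`, hence its integral is of lower order.
  have hG : Tendsto (fun z : ℂ => (2 * Complex.I * z) ^ (P + 1) *
      Complex.exp (-(2 * Complex.I * z * β)) * ∫ τ in (0 : ℝ)..β,
        ((charKernelSlope lam q β τ τ : ℝ) : ℂ) *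
          (Complex.exp (2 * Complex.I * z * τ) * amp lam τ z)) (sectorFilter δ η) (𝓝 0) := by
    have hGD : ∀ τ ∈ Icc 0 β, |charKernelSlope lam q β τ τ| ≤ |D| * β * (β - τ) ^ P := by
      intro τ hτ
      have h0 : 0 ≤ β - τ := sub_nonneg.2 hτ.2
      refine (hD τ hτ).2.trans ?_
      calc D * (β - τ) ^ (P + 1) ≤ |D| * (β - τ) ^ (P + 1) := by
            gcongr
            exact le_abs_self D
        _ = |D| * (β - τ) * (β - τ) ^ P := by ring
        _ ≤ |D| * β * (β - τ) ^ P := by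
            gcongr
            linarith [hτ.1]
    have hGlim : Tendsto (fun τ => charKernelSlope lam q β τ τ / (β - τ) ^ P) (𝓝[<] β) (𝓝 0) := by
      have h0 : Tendsto (fun τ => D * (β - τ)) (𝓝[<] β) (𝓝 0) := by
        have : Tendsto (fun τ => D * (β - τ)) (𝓝 β) (𝓝 (D * (β - β))) :=
          (by fun_prop : Continuous fun τ => D * (β - τ)).tendsto β
        rw [sub_self, mul_zero] at this
        exact this.mono_left nhdsWithin_le_nhds
      refine squeeze_zero_norm' ?_ h0
      filter_upwards [Ioo_mem_nhdsLT hβ] with τ hτ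
      have hp : 0 < (β - τ) ^ P := pow_pos (sub_pos.2 hτ.2) _
      rw [norm_div, Real.norm_eq_abs, Real.norm_eq_abs, abs_of_pos hp, div_le_iff₀ hp]
      refine (hD τ ⟨hτ.1.le, hτ.2.le⟩).2.trans (le_of_eq ?_)
      ring
    have := tendsto_exp_integral hA hl hΛ hβ hGc hGD hGlim
    simpa using this
  have hB := tendsto_normalizer_mul_zero hA hl hΛ hβ (P + 2)
  have hB' := tendsto_normalizer_mul_zero hA' hl hΛ hβ (P + 2)
  have hB1 := tendsto_normalizer_mul_zero hA hl hΛ hβ (P + 1)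
  refine ⟨P + 2, 2 * (c * (P + 1).factorial), ?_, ?_, ?_⟩
  · refine mul_ne_zero two_ne_zero (mul_ne_zero (by exact_mod_cast hc) ?_)
    exact_mod_cast Nat.factorial_ne_zero _
  · have h := hB.add (hK1.const_mul 2)
    rw [zero_add] at h
    refine h.congr fun z => ?_
    rw [jostPlus_at_zero hβ]
    ring
  · have h := hB'.add ((((hG.const_mul 2).add hK2).add
      (hB1.const_mul (2 * ((charKernel lam q β 0 0 : ℝ) : ℂ)))).const_mul (-2))
    have e : (0 : ℂ) + -2 * (2 * 0 + c * (P + 1).factorial +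
        2 * ((charKernel lam q β 0 0 : ℝ) : ℂ) * 0) = -(2 * (c * (P + 1).factorial)) := by ring
    rw [e] at h
    refine h.congr' ?_
    filter_upwards [eventually_mem_goodSet hδ] with z hz
    have hz0 : z ≠ 0 := by
      rintro rfl
      have := hz.1
      norm_num at this
    have hI := Complex.I_ne_zero
    rw [deriv_jostPlus_at_zero hq hβ hη hz hz0]
    field_simp
    ring

/-! ### Reflection -/

lemma jostFreeMinus_eq (lam x : ℝ) (z : ℂ) : jostFreeMinus lam x z = jostFreePlus lam (-x) z := by
  have h : Real.exp (2 * x) / (1 + Real.exp (2 * x)) = 1 / (1 + Real.exp (2 * -x)) := by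
    rw [mul_neg, Real.exp_neg]
    field_simp
    ring
  rw [jostFreeMinus, jostFreePlus, h]
  congr 2
  push_cast
  ring

lemma freePot_neg (lam x : ℝ) : freePot lam (-x) = freePot lam x := by
  simp [freePot]

lemma kernelMinusIter_eq (m : ℕ) (x t : ℝ) : kernelMinusIter lam q α m x t =
    kernelPlusIter lam (fun y => q (-y)) (-α) m (-x) (-t) := by
  induction m generalizing x t with
  | zero =>
    simp only [kernelMinusIter, kernelPlusIter]
    rw [integral_comp_neg (fun s => q s), neg_neg]
    congr 3
    ring
  | succ m ih =>
    simp only [kernelMinusIter, kernelPlusIter]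
    have e1 : (-x + -t) / 2 = -((x + t) / 2) := by ring
    have e2 : (-t - -x) / 2 = -((t - x) / 2) := by ring
    rw [e1, e2, ← integral_comp_neg (fun τ => ∫ u in (0 : ℝ)..(-((t - x) / 2)),
      (pot lam (fun y => q (-y)) (τ - u) - freePot lam (τ + u)) *
        kernelPlusIter lam (fun y => q (-y)) (-α) m (τ - u) (τ + u))]
    refine integral_congr fun τ _ => ?_
    have h := integral_comp_neg (a := (t - x) / 2) (b := 0) (fun u =>
      (pot lam (fun y => q (-y)) (-τ - u) - freePot lam (-τ + u)) *
        kernelPlusIter lam (fun y => q (-y)) (-α) m (-τ - u) (-τ + u))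
    rw [neg_zero] at h
    rw [← h]
    refine integral_congr fun u _ => ?_
    have e3 : -τ - -u = -(τ - u) := by ring
    have e4 : -τ + -u = -(τ + u) := by ring
    simp only [e3, e4, ih, pot, freePot_neg, neg_neg]

lemma jostMinus_eq (x : ℝ) (z : ℂ) : jostMinus lam q α x z =
    jostPlus lam (fun y => q (-y)) (-α) (-x) z := by
  have hK : ∀ t, kernelMinus lam q α x t =
      kernelPlus lam (fun y => q (-y)) (-α) (-x) (-t) := fun t => by
    simp only [kernelMinus, kernelPlus, kernelMinusIter_eq]
  simp only [jostMinus, jostPlus, jostFreeMinus_eq, hK, neg_lt_neg_iff]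
  congr 2
  rw [integral_comp_neg (fun t => ((kernelPlus lam (fun y => q (-y)) (-α) (-x) t : ℝ) : ℂ) *
    jostFreePlus lam t z)]
  congr 1
  ring

lemma derivJumpAt_comp_neg {k : ℕ} (h : DerivJumpAt k q α) :
    DerivJumpAt k (fun y => q (-y)) (-α) := by
  have e : ∀ j, iteratedDeriv j (fun y => q (-y)) =
      fun x => (-1 : ℝ) ^ j * iteratedDeriv j q (-x) := fun j => by
    ext x
    exact iteratedDeriv_comp_neg j q x
  obtain ⟨hd, l, r, hlr, hl, hr⟩ := h
  have hcont : Tendsto (fun x : ℝ => -x) (𝓝 (-α)) (𝓝 α) := by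
    simpa using (continuous_neg (G := ℝ)).tendsto (-α)
  refine ⟨fun j hj => ?_, (-1) ^ k * r, (-1) ^ k * l, ?_, ?_, ?_⟩
  · have ht : Tendsto (fun x : ℝ => -x) (𝓝[≠] (-α)) (𝓝[≠] α) := by
      refine tendsto_nhdsWithin_iff.2 ⟨hcont.mono_left nhdsWithin_le_nhds, ?_⟩
      filter_upwards [self_mem_nhdsWithin] with x hx hxα
      exact hx (by simp [← show -x = α from hxα])
    filter_upwards [ht.eventually (hd j hj)] with x hx
    rw [e]
    exact (hx.comp x differentiableAt_id.neg).const_mul _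
  · intro h
    exact hlr (mul_left_cancel₀ (pow_ne_zero k (neg_ne_zero.2 one_ne_zero)) h).symm
  · rw [e]
    refine (hr.comp (tendsto_nhdsWithin_iff.2
      ⟨hcont.mono_left nhdsWithin_le_nhds, ?_⟩)).const_mul ((-1) ^ k)
    filter_upwards [self_mem_nhdsWithin] with x hx
    simp only [mem_Ioi, mem_Iio] at hx ⊢
    linarith
  · rw [e]
    refine (hl.comp (tendsto_nhdsWithin_iff.2
      ⟨hcont.mono_left nhdsWithin_le_nhds, ?_⟩)).const_mul ((-1) ^ k)
    filter_upwards [self_mem_nhdsWithin] with x hx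
    simp only [mem_Ioi, mem_Iio] at hx ⊢
    linarith

lemma jostW_eq (z : ℂ) : jostW lam q α β z =
    jostPlus lam (fun y => q (-y)) (-α) 0 z * deriv (fun x => jostPlus lam q β x z) 0 +
      deriv (fun x => jostPlus lam (fun y => q (-y)) (-α) x z) 0 * jostPlus lam q β 0 z := by
  have h := deriv_comp_neg (fun x => jostPlus lam (fun y => q (-y)) (-α) x z) 0
  rw [neg_zero] at h
  rw [jostW, wronskian]
  simp only [jostMinus_eq, h, neg_zero]
  ring

/-! ### Absence of resonances -/

/-- The Jost function has no zeros near infinity in the sector, away from the poles. -/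
lemma eventually_jostW_ne_zero (hq : Integrable q) (hsupp : Function.support q ⊆ Icc α β)
    (hα : α < 0) (hβ : 0 < β) {k m : ℕ} (hjumpβ : DerivJumpAt k q β) (hjumpα : DerivJumpAt m q α)
    (hδ : 0 < δ) (hη : 0 < η) : ∀ᶠ z in sectorFilter δ η, jostW lam q α β z ≠ 0 := by
  have hzero : ∀ x, x ∉ Icc α β → q x = 0 := fun x hx => by
    by_contra h
    exact hx (hsupp h)
  obtain ⟨n₁, L₁, hL₁, h1, h1'⟩ := exists_jostPlus_asymptotics (lam := lam) hq
    (fun x hx => hzero x fun h => absurd h.2 (not_le.2 hx)) hβ hjumpβ hδ hη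
  obtain ⟨n₂, L₂, hL₂, h2, h2'⟩ := exists_jostPlus_asymptotics (lam := lam) hq.comp_neg
    (fun x (hx : -α < x) => hzero (-x) fun h => by linarith [h.1]) (neg_pos.2 hα)
    (derivJumpAt_comp_neg hjumpα) hδ hη
  -- Both products of the Wronskian have the same limit, so that they cannot cancel.
  have h := (h2.mul h1').add (h2'.mul h1)
  have hne : L₂ * -L₁ + -L₂ * L₁ ≠ 0 := by
    have e : L₂ * -L₁ + -L₂ * L₁ = -2 * (L₁ * L₂) := by ring
    rw [e]
    exact mul_ne_zero (by norm_num) (mul_ne_zero hL₁ hL₂)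
  filter_upwards [h.eventually_ne hne] with z hz hw
  refine hz ?_
  rw [jostW_eq] at hw
  linear_combination ((2 * Complex.I * z) ^ n₁ * Complex.exp (-(2 * Complex.I * z * β)) *
    ((2 * Complex.I * z) ^ n₂ * Complex.exp (-(2 * Complex.I * z * ((-α : ℝ) : ℂ)))) /
      (Complex.I * z)) * hw

lemma exists_radius_jostW_ne_zero (hq : Integrable q) (hsupp : Function.support q ⊆ Icc α β)
    (hα : α < 0) (hβ : 0 < β) {k m : ℕ} (hjumpβ : DerivJumpAt k q β) (hjumpα : DerivJumpAt m q α)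
    (hδ : 0 < δ) (hη : 0 < η) :
    ∃ R : ℝ, ∀ z ∈ sectorOne δ \ discs η, R ≤ ‖z‖ → jostW lam q α β z ≠ 0 := by
  have h := eventually_jostW_ne_zero (lam := lam) hq hsupp hα hβ hjumpβ hjumpα hδ hη
  rw [sectorFilter, eventually_inf_principal, eventually_comap] at h
  obtain ⟨R, hR⟩ := eventually_atTop.1 h
  exact ⟨R, fun z hz hzR => hR ‖z‖ hzR z rfl hz⟩

/-- Points at bounded distance from a far point of the sector lie in a slightly wider sector. -/
lemma mem_sectorOne_of_mem_closedBall (hδ : 0 < δ) {ε : ℝ} (hε : 0 < ε) {z₀ z : ℂ}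
    (hz₀ : z₀ ∈ sectorOne δ) (hR : (1 + δ) * (ε * (2 + δ)) ≤ ‖z₀‖)
    (hz : z ∈ Metric.closedBall z₀ ε) : z ∈ sectorOne (δ + 1) := by
  have h1 : ε * (2 + δ) ≤ -z₀.im :=
    le_of_mul_le_mul_left (hR.trans (norm_le_of_mem_sectorOne hz₀)) (by linarith)
  rw [Metric.mem_closedBall, dist_eq_norm] at hz
  have him := (abs_le.1 ((Complex.abs_im_le_norm (z - z₀)).trans hz)).2
  have hre := (Complex.abs_re_le_norm (z - z₀)).trans hz
  rw [Complex.sub_im] at him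
  rw [Complex.sub_re] at hre
  have h2 : -|z₀.re| ≥ δ * z₀.im := hz₀.2
  have h3 := abs_sub_abs_le_abs_sub z.re z₀.re
  have h4 : δ * z.im ≤ δ * (z₀.im + ε) := mul_le_mul_of_nonneg_left (by linarith) hδ.le
  have h5 : 0 < ε * δ := mul_pos hε hδ
  constructor
  · linarith
  · linarith

end PoschlTeller

end

theorem mainTheorem6 (lam α β : ℝ) (q : ℝ → ℝ) (p r : ℕ)
    (hq : Integrable q volume) (hsupp : Function.support q ⊆ Set.Icc α β)
    (hα : α < 0) (hβ : 0 < β) (hp : 1 ≤ p) (hr : 1 ≤ r)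
    (hjumpβ : PoschlTeller.DerivJumpAt (p - 1) q β)
    (hjumpα : PoschlTeller.DerivJumpAt (r - 1) q α)
    (δ η : ℝ) (hδ : 0 < δ) (hη : 0 < η) :
    (∃ R : ℝ, ∀ z ∈ PoschlTeller.sectorOne δ \
          (PoschlTeller.discs η ∪ PoschlTeller.zeroSet lam q α β),
        R ≤ ‖z‖ → PoschlTeller.jostW lam q α β z ≠ 0) ∧
    (∀ ε > 0, ∃ R : ℝ, ∀ z₀ ∈ PoschlTeller.sectorOne δ,
        PoschlTeller.jostFreeW lam z₀ = 0 → R ≤ ‖z₀‖ →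
        ∀ z ∈ Metric.closedBall z₀ ε, z ∉ PoschlTeller.discs η →
          PoschlTeller.jostW lam q α β z ≠ 0) := by
  refine ⟨?_, fun ε hε => ?_⟩
  · obtain ⟨R, hR⟩ := PoschlTeller.exists_radius_jostW_ne_zero (lam := lam) hq hsupp hα hβ hjumpβ
      hjumpα hδ hη
    exact ⟨R, fun z hz hzR => hR z ⟨hz.1, fun h => hz.2 (Or.inl h)⟩ hzR⟩
  · obtain ⟨R, hR⟩ := PoschlTeller.exists_radius_jostW_ne_zero (lam := lam) hq hsupp hα hβ hjumpβ
      hjumpα (by linarith : 0 < δ + 1) hη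
    refine ⟨max (R + ε) ((1 + δ) * (ε * (2 + δ))), fun z₀ hz₀ _ hz₀R z hz hzη => ?_⟩
    refine hR z ⟨PoschlTeller.mem_sectorOne_of_mem_closedBall hδ hε hz₀
      ((le_max_right _ _).trans hz₀R) hz, hzη⟩ ?_
    rw [Metric.mem_closedBall, dist_eq_norm] at hz
    have h1 := (le_max_left (R + ε) _).trans hz₀R
    have h2 := norm_sub_norm_le z₀ z
    rw [norm_sub_rev] at h2
    linarith
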